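/- **Kleene realizability.** For $n,p\in\mathbb N$ write $n.p$ for the (possibly undefined) value at $p$ of the $n$-th partial recursive function. For subsets $\phi,\psi\subseteq\mathbb N$ let $\phi\wedge\psi=\{\langle a,b\rangle: a\in\phi,\ b\in\psi\}$ (with a recursive pairing bijection $\langle\cdot,\cdot\rangle$) and $\phi\rightarrow\psi=\{n:\ n.a \text{ is defined and } n.a\in\psi\text{ for all }a\in\phi\}$. For a set $X$ and $\phi,\psi:X\to\mathcal P(\mathbb N)$ write $\phi\le\psi$ if there is one $n$ with $n\in\phi(x)\rightarrow\psi(x)$ for all $x\in X$. A sentence $S\subseteq\mathbb N$ is *valid* if $\mathbb N\le S$ (equivalently, $S\neq\emptyset$). **The effective topos.** An object of $\mathcal{E}\!f\!f$ is a pair $(A,\rho)$ of a set $A$ and a map $\rho:A\times A\to\mathcal P(\mathbb N)$ such that $\bigcap_{x,y}\rho(x,y)\rightarrow\rho(y,x)$ and $\bigcap_{x,y,z}\rho(x,y)\wedge\rho(y,z)\rightarrow\rho(x,z)$ are valid. A functional relation $(A,\rho)\to(B,\sigma)$ is a map $F:A\times B\to\mathcal P(\mathbb N)$ such that the sentences $$\bigcap_{a,b}F(a,b)\rightarrow\rho(a,a)\wedge\sigma(b,b),\qquad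 \bigcap_{a,a',b,b'}F(a,b)\wedge\rho(a,a')\wedge\sigma(b,b')\rightarrow F(a',b'),$$ $$\bigcap_{a,b,b'}F(a,b)\wedge F(a,b')\rightarrow\sigma(b,b'),\qquad \bigcap_a\Big[\rho(a,a)\rightarrow\bigcup_bF(a,b)\Big]$$ are valid. Arrows are functional relations modulo $F\sim G\iff F\le G$ and $G\le F$; the identity of $(A,\rho)$ is $\rho$, and the composite of $F$ and $G$ is $(a,c)\mapsto\bigcup_bF(a,b)\wedge G(b,c)$. Write $1=(\{*\},\top)$ with $\top(*,*)=\mathbb N$, and $!_A:(A,\rho)\to 1$ for the arrow represented by $(a,*)\mapsto\rho(a,a)$. A map $P:A\to\mathcal P(\mathbb N)$ is *strict and relational* over $(A,\rho)$ if $\bigcap_xP(x)\rightarrow\rho(x,x)$ and $\bigcap_{x,y}\rho(x,y)\wedge P(x)\rightarrow P(y)$ are valid; it represents the subobject $\rho_P:(A,\rho_P)\rightarrowtail(A,\rho)$, where $\rho_P(x,y)=\rho(x,y)\wedge P(x)$ defines both the object $(A,\rho_P)$ and the functional relation. Every sentence $S$ is strict and relational over $1$, and so represents a subobject of $1$. **Hilbertian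 toposes.** An elementary topos (a category with finite limits and power objects) is *Hilbertian* if for every monomorphism $p:X\rightarrowtail A$ such that $A\to1$ is epic there are an epi–mono factorization $X\twoheadrightarrow U\overset{m}{\rightarrowtail}1$ of $X\to 1$, an arrow $\varepsilon:1\to A$ and an arrow $w:U\to X$ with $p\circ w=\varepsilon\circ m$. Its internal language *validates the partial $\varepsilon$-calculus* if for every object $A$ that is not initial and every formula $\psi:X\rightarrowtail A$ there is $\varepsilon:1\to A$ such that the subobject $\exists x{:}A.\,\psi$ of $1$ (the image of $X$ in $1$) factors through $\psi[\varepsilon/x]$ (the pullback of $\psi$ along $\varepsilon$). It *validates the axiom of choice* if every epimorphism splits. **Proposition.** 1. $\mathcal{E}\!f\!f$ is an elementary topos, and it is Hilbertian. 2. The internal language of $\mathcal{E}\!f\!f$ validates the partial $\varepsilon$-calculus. 3. $\mathcal{E}\!f\!f$ does not validate the axiom of choice. 4. Explicitly: $1$ is terminal in $\mathcal{E}\!f\!f$. Let $(A,\rho)$ be an object such that $!_A$ is epic, and let $P$ be strict and relational over $(A,\rho)$. Then $\rho_P$ is monic, the subobject of $1$ represented by the sentence $\bigcup_{a\in A}P(a)$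 is the image of $(A,\rho_P)\rightarrowtail(A,\rho)\to1$ (that is, $\,!_A\circ\rho_P$ factors as an epimorphism followed by its inclusion into $1$, which is monic), and there is a global element $\varepsilon:1\to(A,\rho)$ such that this same subobject of $1$ is the pullback of $\rho_P$ along $\varepsilon$. -/

import Mathlib

open CategoryTheory CategoryTheory.Limits

universe v u

namespace EffTopos

/-! ## Elementary toposes, Hilbertian toposes and the partial epsilon-calculus -/

section General

/-- A power object of `B` in a category with finite limits: an object `P` with a relation
`mem : E ↣ B × P` such that every relation `r : R ↣ B × A` is the pullback of `mem` along
`id × f` for a unique `f : A ⟶ P`. -/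
def IsPowerObject {C : Type u} [Category.{v} C] [HasFiniteLimits C] (B P : C) {E : C}
    (mem : E ⟶ B ⨯ P) : Prop :=
  Mono mem ∧ ∀ (A R : C) (r : R ⟶ B ⨯ A), Mono r →
    ∃! f : A ⟶ P, ∃ g : R ⟶ E, IsPullback g r mem (prod.map (𝟙 B) f)

/-- An elementary topos: a category with finite limits and power objects. -/
class ElementaryTopos (C : Type u) [Category.{v} C] : Prop where
  hasFiniteLimits : HasFiniteLimits C
  exists_powerObject : ∀ B : C, ∃ (P E : C) (mem : E ⟶ B ⨯ P), IsPowerObject B P mem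

/-- An elementary topos is Hilbertian if every diagram `X ↣ A ↠ 1` can be expanded to a
commutative diagram consisting of `X ↠ U ↣ 1`, `ε : 1 ⟶ A` and `U ⟶ X`, where the square with
sides `U ↣ 1`, `ε`, `U ⟶ X` and `p` commutes.
(The equality `e ≫ m = p ≫ !` of maps to the terminal object is automatic; it is recorded to show
that `U ↣ 1` is the image of `X`.) -/
def IsHilbertian (C : Type u) [Category.{v} C] [ElementaryTopos C] : Prop :=
  ∀ (T : C) (hT : IsTerminal T) (X A : C) (p : X ⟶ A), Mono p → Epi (hT.from A) →
    ∃ (U : C) (e : X ⟶ U) (m : U ⟶ T) (ε : T ⟶ A) (w : U ⟶ X),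
      Epi e ∧ Mono m ∧ e ≫ m = p ≫ hT.from A ∧ w ≫ p = m ≫ ε

/-- The internal language validates the partial epsilon-calculus: for every non-initial `A` and
every formula `ψ : X ↣ A` there is a closed term `ε : 1 ⟶ A` such that the sequent
`∃ x : A, ψ ⊢ ψ[ε/x]` is derivable, that is, the mono `m : U ↣ 1` representing `∃ x : A, ψ` (the
image of `X` in `1`) factors through the mono `k : V ⟶ 1` representing `ψ[ε/x]` (the pullback of
`ψ` along `ε`). -/
def ValidatesPartialEpsilon (C : Type u) [Category.{v} C] [ElementaryTopos C] : Prop :=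
  ∀ (T : C) (hT : IsTerminal T) (X A : C) (ψ : X ⟶ A), Mono ψ → IsEmpty (IsInitial A) →
    ∃ (ε : T ⟶ A) (U : C) (e : X ⟶ U) (m : U ⟶ T) (V : C) (q : V ⟶ X) (k : V ⟶ T),
      Epi e ∧ Mono m ∧ e ≫ m = ψ ≫ hT.from A ∧ IsPullback q k ψ ε ∧ ∃ j : U ⟶ V, j ≫ k = m

end General

/-! ## Kleene realizability -/

section Realizability

/-- Kleene application `n.p`: the `n`-th partial recursive function applied to `p`. -/
def app (n p : ℕ) : Part ℕ := (Nat.Partrec.Code.ofNatCode n).eval p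

/-- The Kleene realizability preorder on `P(ℕ)^X`. -/
def RLe {X : Type*} (φ ψ : X → Set ℕ) : Prop :=
  ∃ n : ℕ, ∀ x, ∀ a ∈ φ x, ∃ b ∈ app n a, b ∈ ψ x

/-- Realizability conjunction (the meet of the realizability order, computed pointwise). -/
def conj (φ ψ : Set ℕ) : Set ℕ := {n | n.unpair.1 ∈ φ ∧ n.unpair.2 ∈ ψ}

/-- Realizability implication (relative pseudocomplement, computed pointwise). -/
def imp (φ ψ : Set ℕ) : Set ℕ := {n | ∀ a ∈ φ, ∃ b ∈ app n a, b ∈ ψ}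

/-- A sentence is valid if it is above the top sentence in the realizability order. -/
def Valid (S : Set ℕ) : Prop := RLe (fun _ : Unit => Set.univ) (fun _ : Unit => S)

theorem RLe.of_code {X : Type*} {φ ψ : X → Set ℕ} (c : Nat.Partrec.Code)
    (h : ∀ x, ∀ a ∈ φ x, ∃ b ∈ c.eval a, b ∈ ψ x) : RLe φ ψ := by
  refine ⟨Encodable.encode c, fun x a ha => ?_⟩
  have : Nat.Partrec.Code.ofNatCode (Encodable.encode c) = c := by
    rw [← Nat.Partrec.Code.ofNatCode_eq, Denumerable.ofNat_encode]
  simpa [app, this] using h x a ha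

theorem RLe.of_map {X : Type*} {φ ψ : X → Set ℕ} (c : Nat.Partrec.Code) (f : ℕ → ℕ)
    (hc : ∀ a, c.eval a = Part.some (f a)) (h : ∀ x, ∀ a ∈ φ x, f a ∈ ψ x) : RLe φ ψ :=
  RLe.of_code c fun x a ha => ⟨f a, by simp [hc], h x a ha⟩

theorem RLe.of_subset {X : Type*} {φ ψ : X → Set ℕ} (h : ∀ x, φ x ⊆ ψ x) : RLe φ ψ :=
  RLe.of_map Nat.Partrec.Code.id id (by simp) fun x _ ha => h x ha

theorem RLe.refl {X : Type*} (φ : X → Set ℕ) : RLe φ φ := RLe.of_subset fun _ => subset_rfl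

theorem RLe.trans {X : Type*} {φ ψ χ : X → Set ℕ} (h : RLe φ ψ) (k : RLe ψ χ) : RLe φ χ := by
  obtain ⟨n, hn⟩ := h
  obtain ⟨m, hm⟩ := k
  refine RLe.of_code ((Nat.Partrec.Code.ofNatCode m).comp (Nat.Partrec.Code.ofNatCode n))
    fun x a ha => ?_
  obtain ⟨b, hb, hb'⟩ := hn x a ha
  obtain ⟨c, hc, hc'⟩ := hm x b hb'
  exact ⟨c, Part.mem_bind hb hc, hc'⟩

theorem RLe.comap {X Y : Type*} {φ ψ : X → Set ℕ} (h : RLe φ ψ) (f : Y → X) :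
    RLe (fun y => φ (f y)) (fun y => ψ (f y)) := by
  obtain ⟨n, hn⟩ := h
  exact ⟨n, fun y => hn (f y)⟩

theorem RLe.and {X : Type*} {Γ φ ψ : X → Set ℕ} (h : RLe Γ φ) (k : RLe Γ ψ) :
    RLe Γ (fun x => conj (φ x) (ψ x)) := by
  obtain ⟨n, hn⟩ := h
  obtain ⟨m, hm⟩ := k
  refine RLe.of_code ((Nat.Partrec.Code.ofNatCode n).pair (Nat.Partrec.Code.ofNatCode m))
    fun x a ha => ?_
  obtain ⟨b, hb, hb'⟩ := hn x a ha
  obtain ⟨c, hc, hc'⟩ := hm x a ha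
  refine ⟨Nat.pair b c, ?_, by simp [conj, hb', hc']⟩
  have h1 := Part.eq_some_iff.2 hb
  have h2 := Part.eq_some_iff.2 hc
  simp only [app] at h1 h2
  simp [Nat.Partrec.Code.eval, h1, h2, Seq.seq]

theorem RLe.left {X : Type*} {Γ φ ψ : X → Set ℕ} (h : RLe Γ (fun x => conj (φ x) (ψ x))) :
    RLe Γ φ :=
  h.trans (RLe.of_map Nat.Partrec.Code.left (fun n => n.unpair.1)
    (by simp [Nat.Partrec.Code.eval]) fun _ _ ha => ha.1)

theorem RLe.right {X : Type*} {Γ φ ψ : X → Set ℕ} (h : RLe Γ (fun x => conj (φ x) (ψ x))) :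
    RLe Γ ψ :=
  h.trans (RLe.of_map Nat.Partrec.Code.right (fun n => n.unpair.2)
    (by simp [Nat.Partrec.Code.eval]) fun _ _ ha => ha.2)

theorem RLe.exI {X B : Type*} {Γ : X → Set ℕ} {φ : X → B → Set ℕ} (b : X → B)
    (h : RLe Γ (fun x => φ x (b x))) : RLe Γ (fun x => ⋃ b, φ x b) :=
  h.trans (RLe.of_subset fun x => Set.subset_iUnion (φ x) (b x))

theorem RLe.exE {X B : Type*} {Γ ψ : X → Set ℕ} {φ : X → B → Set ℕ}
    (h : RLe Γ (fun x => ⋃ b, φ x b))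
    (k : RLe (fun p : X × B => conj (Γ p.1) (φ p.1 p.2)) (fun p => ψ p.1)) : RLe Γ ψ := by
  refine ((RLe.refl Γ).and h).trans ?_
  obtain ⟨n, hn⟩ := k
  refine ⟨n, fun x a ha => ?_⟩
  obtain ⟨b, hb⟩ := Set.mem_iUnion.1 ha.2
  exact hn (x, b) a ⟨ha.1, hb⟩

theorem RLe.const {X : Type*} {Γ : X → Set ℕ} {S : X → Set ℕ} (n : ℕ) (h : ∀ x, n ∈ S x) :
    RLe Γ S :=
  RLe.of_map (Nat.Partrec.Code.const n) (fun _ => n) (by simp) fun x _ _ => h x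

theorem valid_iff {S : Set ℕ} : Valid S ↔ S.Nonempty := by
  constructor
  · rintro ⟨n, hn⟩
    obtain ⟨b, -, hb⟩ := hn () 0 trivial
    exact ⟨b, hb⟩
  · rintro ⟨n, hn⟩
    exact RLe.const n fun _ => hn

theorem valid₁ {X : Type*} {φ ψ : X → Set ℕ} : Valid (⋂ x, imp (φ x) (ψ x)) ↔ RLe φ ψ := by
  simp [valid_iff, Set.Nonempty, imp, RLe]

theorem valid₂ {X Y : Type*} {φ ψ : X → Y → Set ℕ} :
    Valid (⋂ x, ⋂ y, imp (φ x y) (ψ x y)) ↔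
      RLe (fun p : X × Y => φ p.1 p.2) (fun p => ψ p.1 p.2) := by
  simp [valid_iff, Set.Nonempty, imp, RLe]

theorem valid₃ {X Y Z : Type*} {φ ψ : X → Y → Z → Set ℕ} :
    Valid (⋂ x, ⋂ y, ⋂ z, imp (φ x y z) (ψ x y z)) ↔
      RLe (fun p : X × Y × Z => φ p.1 p.2.1 p.2.2) (fun p => ψ p.1 p.2.1 p.2.2) := by
  simp [valid_iff, Set.Nonempty, imp, RLe]

theorem valid₄ {X Y Z W : Type*} {φ ψ : X → Y → Z → W → Set ℕ} :
    Valid (⋂ x, ⋂ y, ⋂ z, ⋂ w, imp (φ x y z w) (ψ x y z w)) ↔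
      RLe (fun p : X × Y × Z × W => φ p.1 p.2.1 p.2.2.1 p.2.2.2)
        (fun p => ψ p.1 p.2.1 p.2.2.1 p.2.2.2) := by
  simp [valid_iff, Set.Nonempty, imp, RLe]

end Realizability

/-! ## The effective topos -/

/-- An object of the effective topos: a set with a realizability partial equivalence relation. -/
structure Eff : Type (u + 1) where
  carrier : Type u
  rel : carrier → carrier → Set ℕ
  symm : Valid (⋂ x, ⋂ y, imp (rel x y) (rel y x))
  trans : Valid (⋂ x, ⋂ y, ⋂ z, imp (conj (rel x y) (rel y z)) (rel x z))

/-- A functional relation from `(A, ρ)` to `(B, σ)`. -/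
structure IsFunctional (A B : Eff.{u}) (F : A.carrier → B.carrier → Set ℕ) : Prop where
  strict : Valid (⋂ a, ⋂ b, imp (F a b) (conj (A.rel a a) (B.rel b b)))
  relational : Valid (⋂ a, ⋂ a', ⋂ b, ⋂ b',
    imp (conj (conj (F a b) (A.rel a a')) (B.rel b b')) (F a' b'))
  singleValued : Valid (⋂ a, ⋂ b, ⋂ b', imp (conj (F a b) (F a b')) (B.rel b b'))
  total : Valid (⋂ a, imp (A.rel a a) (⋃ b, F a b))

namespace Eff

section PER

variable {A : Eff.{u}} {X : Type*} {Γ : X → Set ℕ} {a b c : X → A.carrier}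

theorem symm' (h : RLe Γ (fun x => A.rel (a x) (b x))) : RLe Γ (fun x => A.rel (b x) (a x)) :=
  h.trans ((valid₂.1 A.symm).comap fun x => (a x, b x))

theorem trans' (h : RLe Γ (fun x => A.rel (a x) (b x))) (k : RLe Γ (fun x => A.rel (b x) (c x))) :
    RLe Γ (fun x => A.rel (a x) (c x)) :=
  (h.and k).trans ((valid₃.1 A.trans).comap fun x => (a x, b x, c x))

theorem refl_left (h : RLe Γ (fun x => A.rel (a x) (b x))) : RLe Γ (fun x => A.rel (a x) (a x)) :=
  trans' h (symm' h)

theorem refl_right (h : RLe Γ (fun x => A.rel (a x) (b x))) : RLe Γ (fun x => A.rel (b x) (b x)) :=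
  trans' (symm' h) h

end PER

end Eff

namespace IsFunctional

section Rules

variable {A B : Eff.{u}} {F : A.carrier → B.carrier → Set ℕ}
  {X : Type*} {Γ : X → Set ℕ} {a a' : X → A.carrier} {b b' : X → B.carrier}

theorem dom (hF : IsFunctional A B F) (h : RLe Γ (fun x => F (a x) (b x))) :
    RLe Γ (fun x => A.rel (a x) (a x)) :=
  (h.trans ((valid₂.1 hF.strict).comap fun x => (a x, b x))).left

theorem cod (hF : IsFunctional A B F) (h : RLe Γ (fun x => F (a x) (b x))) :
    RLe Γ (fun x => B.rel (b x) (b x)) :=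
  (h.trans ((valid₂.1 hF.strict).comap fun x => (a x, b x))).right

theorem subst (hF : IsFunctional A B F) (h : RLe Γ (fun x => F (a x) (b x)))
    (ha : RLe Γ (fun x => A.rel (a x) (a' x))) (hb : RLe Γ (fun x => B.rel (b x) (b' x))) :
    RLe Γ (fun x => F (a' x) (b' x)) :=
  ((h.and ha).and hb).trans
    ((valid₄.1 hF.relational).comap fun x => (a x, a' x, b x, b' x))

theorem unique (hF : IsFunctional A B F) (h : RLe Γ (fun x => F (a x) (b x)))
    (h' : RLe Γ (fun x => F (a x) (b' x))) : RLe Γ (fun x => B.rel (b x) (b' x)) :=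
  (h.and h').trans ((valid₃.1 hF.singleValued).comap fun x => (a x, b x, b' x))

theorem exists_of (hF : IsFunctional A B F) (h : RLe Γ (fun x => A.rel (a x) (a x))) :
    RLe Γ (fun x => ⋃ b, F (a x) b) :=
  h.trans ((valid₁.1 hF.total).comap a)

end Rules

theorem id (A : Eff.{u}) : IsFunctional A A A.rel where
  strict := valid₂.2 ((Eff.refl_left (RLe.refl _)).and (Eff.refl_right (RLe.refl _)))
  relational := valid₄.2 (Eff.trans' (Eff.symm' (RLe.refl _).left.right)
    (Eff.trans' (RLe.refl _).left.left (RLe.refl _).right))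
  singleValued := valid₃.2 (Eff.trans' (Eff.symm' (RLe.refl _).left) (RLe.refl _).right)
  total := valid₁.2 (RLe.exI (fun x => x) (RLe.refl _))

/-- Relational composition. -/
theorem comp {A B C : Eff.{u}} {F : A.carrier → B.carrier → Set ℕ}
    {G : B.carrier → C.carrier → Set ℕ} (hF : IsFunctional A B F) (hG : IsFunctional B C G) :
    IsFunctional A C (fun a c => ⋃ b, conj (F a b) (G b c)) where
  strict := valid₂.2 ((RLe.refl _).exE
    ((hF.dom (RLe.refl _).right.left).and (hG.cod (RLe.refl _).right.right)))
  relational := valid₄.2 ((RLe.refl _).left.left.exE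
    (RLe.exI (fun p => p.2)
      ((hF.subst (RLe.refl _).right.left (RLe.refl _).left.left.right
          (hF.cod (RLe.refl _).right.left)).and
        (hG.subst (RLe.refl _).right.right (hG.dom (RLe.refl _).right.right)
          (RLe.refl _).left.right))))
  singleValued := valid₃.2 ((RLe.refl _).left.exE
    ((RLe.refl _).left.right.exE
      (hG.unique
        (hG.subst (RLe.refl _).left.right.right
          (hF.unique (RLe.refl _).left.right.left (RLe.refl _).right.left)
          (hG.cod (RLe.refl _).left.right.right))
        (RLe.refl _).right.right)))
  total := valid₁.2 ((hF.exists_of (RLe.refl _)).exE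
    ((hG.exists_of (hF.cod (RLe.refl _).right)).exE
      (RLe.exI (fun p => p.2) (RLe.exI (fun p => p.1.2)
        ((RLe.refl _).left.right.and (RLe.refl _).right)))))

end IsFunctional

namespace Eff

/-- Functional relations, up to equality in the poset reflection of `P(ℕ)^(A × B)`. -/
instance functionalSetoid (A B : Eff.{u}) :
    Setoid {F : A.carrier → B.carrier → Set ℕ // IsFunctional A B F} where
  r F G := RLe (fun p : A.carrier × B.carrier => F.1 p.1 p.2) (fun p => G.1 p.1 p.2) ∧
    RLe (fun p : A.carrier × B.carrier => G.1 p.1 p.2) (fun p => F.1 p.1 p.2)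
  iseqv :=
    { refl := fun _ => ⟨RLe.refl _, RLe.refl _⟩
      symm := fun h => ⟨h.2, h.1⟩
      trans := fun h k => ⟨h.1.trans k.1, k.2.trans h.2⟩ }

/-- Arrows of the effective topos: equivalence classes of functional relations. -/
def Hom (A B : Eff.{u}) : Type u := Quotient (functionalSetoid A B)

/-- The arrow represented by a functional relation. -/
def Hom.mk {A B : Eff.{u}} (F : A.carrier → B.carrier → Set ℕ) (hF : IsFunctional A B F) :
    Hom A B := Quotient.mk _ ⟨F, hF⟩

theorem comp_mono {A B C : Eff.{u}} {F F' : A.carrier → B.carrier → Set ℕ}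
    {G G' : B.carrier → C.carrier → Set ℕ}
    (h : RLe (fun p : A.carrier × B.carrier => F p.1 p.2) (fun p => F' p.1 p.2))
    (k : RLe (fun p : B.carrier × C.carrier => G p.1 p.2) (fun p => G' p.1 p.2)) :
    RLe (fun p : A.carrier × C.carrier => ⋃ b, conj (F p.1 b) (G b p.2))
      (fun p => ⋃ b, conj (F' p.1 b) (G' b p.2)) :=
  (RLe.refl _).exE (RLe.exI (fun p => p.2)
    (((RLe.refl _).right.left.trans
        (h.comap fun p : (A.carrier × C.carrier) × B.carrier => (p.1.1, p.2))).and
      ((RLe.refl _).right.right.trans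
        (k.comap fun p : (A.carrier × C.carrier) × B.carrier => (p.2, p.1.2)))))

/-- Composition of arrows, induced by relational composition. -/
def Hom.comp {A B C : Eff.{u}} (f : Hom A B) (g : Hom B C) : Hom A C :=
  Quotient.map₂ (fun F G => ⟨fun a c => ⋃ b, conj (F.1 a b) (G.1 b c), F.2.comp G.2⟩)
    (fun _ _ (h : _ ∧ _) _ _ (k : _ ∧ _) => ⟨comp_mono h.1 k.1, comp_mono h.2 k.2⟩) f g

/-- The effective topos as a category. -/
instance : Category.{u} Eff.{u} where
  Hom A B := Hom A B
  id A := Hom.mk A.rel (IsFunctional.id A)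
  comp f g := Hom.comp f g
  id_comp := by
    rintro A B ⟨F, hF⟩
    refine Quotient.sound ⟨?_, ?_⟩
    · exact (RLe.refl _).exE (hF.subst (RLe.refl _).right.right
        (symm' (RLe.refl _).right.left) (hF.cod (RLe.refl _).right.right))
    · exact RLe.exI (fun p : A.carrier × B.carrier => p.1) ((hF.dom (RLe.refl _)).and (RLe.refl _))
  comp_id := by
    rintro A B ⟨F, hF⟩
    refine Quotient.sound ⟨?_, ?_⟩
    · exact (RLe.refl _).exE (hF.subst (RLe.refl _).right.left
        (hF.dom (RLe.refl _).right.left) (RLe.refl _).right.right)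
    · exact RLe.exI (fun p : A.carrier × B.carrier => p.2) ((RLe.refl _).and (hF.cod (RLe.refl _)))
  assoc := by
    rintro A B C D ⟨F, hF⟩ ⟨G, hG⟩ ⟨H, hH⟩
    refine Quotient.sound ⟨?_, ?_⟩
    · exact (RLe.refl _).exE ((RLe.refl _).right.left.exE (RLe.exI
        (fun p : ((A.carrier × D.carrier) × C.carrier) × B.carrier => p.2)
        ((RLe.refl _).right.left.and (RLe.exI
          (fun p : ((A.carrier × D.carrier) × C.carrier) × B.carrier => p.1.2)
          ((RLe.refl _).right.right.and (RLe.refl _).left.right.right)))))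
    · exact (RLe.refl _).exE ((RLe.refl _).right.right.exE (RLe.exI
        (fun p : ((A.carrier × D.carrier) × B.carrier) × C.carrier => p.2)
        ((RLe.exI (fun p : ((A.carrier × D.carrier) × B.carrier) × C.carrier => p.1.2)
          ((RLe.refl _).left.right.left.and (RLe.refl _).right.left)).and
            (RLe.refl _).right.right)))

/-- The arrow of the effective topos represented by a functional relation. -/
def ofFunctional {A B : Eff.{u}} (F : A.carrier → B.carrier → Set ℕ) (hF : IsFunctional A B F) :
    A ⟶ B := Hom.mk F hF

/-- The terminal object `(1, ⊤)`. -/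
def one : Eff.{u} where
  carrier := PUnit
  rel _ _ := Set.univ
  symm := valid₂.2 (RLe.of_subset fun _ => Set.subset_univ _)
  trans := valid₃.2 (RLe.of_subset fun _ => Set.subset_univ _)

theorem isFunctional_toOne (A : Eff.{u}) : IsFunctional A one (fun a _ => A.rel a a) where
  strict := valid₂.2 ((RLe.refl _).and (RLe.const 0 fun _ => trivial))
  relational := valid₄.2 (refl_right (RLe.refl _).left.right)
  singleValued := valid₃.2 (RLe.const 0 fun _ => trivial)
  total := valid₁.2 (RLe.exI (fun _ => PUnit.unit) (RLe.refl _))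

/-- The arrow `(A, ρ) ⟶ (1, ⊤)`, given by `x ↦ ρ(x, x)`. -/
def toOne (A : Eff.{u}) : A ⟶ one := ofFunctional _ (isFunctional_toOne A)

/-- A strict and relational proposition over `(A, ρ)`. -/
structure IsStrictRel (A : Eff.{u}) (P : A.carrier → Set ℕ) : Prop where
  strict : Valid (⋂ x, imp (P x) (A.rel x x))
  relational : Valid (⋂ x, ⋂ y, imp (conj (A.rel x y) (P x)) (P y))

theorem IsStrictRel.subst {A : Eff.{u}} {P : A.carrier → Set ℕ} (hP : A.IsStrictRel P)
    {X : Type*} {Γ : X → Set ℕ} {a b : X → A.carrier} (h : RLe Γ (fun x => A.rel (a x) (b x)))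
    (k : RLe Γ (fun x => P (a x))) : RLe Γ (fun x => P (b x)) :=
  (h.and k).trans ((valid₂.1 hP.relational).comap fun x => (a x, b x))

/-- The object `(A, ρ_P)` with `ρ_P(x, y) = ρ(x, y) ∧ P(x)`. -/
def sub (A : Eff.{u}) (P : A.carrier → Set ℕ) (hP : A.IsStrictRel P) : Eff.{u} where
  carrier := A.carrier
  rel x y := conj (A.rel x y) (P x)
  symm := valid₂.2 ((symm' (RLe.refl _).left).and (hP.subst (RLe.refl _).left (RLe.refl _).right))
  trans := valid₃.2 ((trans' (RLe.refl _).left.left (RLe.refl _).right.left).and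
    (RLe.refl _).left.right)

theorem isFunctional_incl (A : Eff.{u}) (P : A.carrier → Set ℕ) (hP : A.IsStrictRel P) :
    IsFunctional (A.sub P hP) A (fun x y => conj (A.rel x y) (P x)) where
  strict := valid₂.2 (((refl_left (RLe.refl _).left).and (RLe.refl _).right).and
    (refl_right (RLe.refl _).left))
  relational := valid₄.2 ((trans' (symm' (RLe.refl _).left.right.left)
    (trans' (RLe.refl _).left.left.left (RLe.refl _).right)).and
      (hP.subst (RLe.refl _).left.right.left (RLe.refl _).left.right.right))
  singleValued := valid₃.2 (trans' (symm' (RLe.refl _).left.left) (RLe.refl _).right.left)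
  total := valid₁.2 (RLe.exI (fun x => x) (RLe.refl _))

/-- The arrow `ρ_P : (A, ρ_P) ⟶ (A, ρ)`, the subobject represented by `P`. -/
def incl (A : Eff.{u}) (P : A.carrier → Set ℕ) (hP : A.IsStrictRel P) : A.sub P hP ⟶ A :=
  ofFunctional _ (isFunctional_incl A P hP)

/-- Every sentence is a strict and relational proposition over `(1, ⊤)`. -/
theorem isStrictRel_one (S : Set ℕ) : one.{u}.IsStrictRel (fun _ => S) where
  strict := valid₁.2 (RLe.const 0 fun _ => trivial)
  relational := valid₂.2 (RLe.refl _).right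

/-- The subobject of `(1, ⊤)` represented by the sentence `S`: its domain. -/
def subOne (S : Set ℕ) : Eff.{u} := one.sub (fun _ => S) (isStrictRel_one S)

/-- The subobject of `(1, ⊤)` represented by the sentence `S`: its inclusion arrow. -/
def inclOne (S : Set ℕ) : subOne.{u} S ⟶ one.{u} := one.incl (fun _ => S) (isStrictRel_one S)

end Eff

end EffTopos

/-!
The realizability order `RLe` interprets intuitionistic predicate logic: conjunction and existential
quantification hold pointwise, and implication under a universal quantifier is interpreted by
currying codes (`RLe.allImpI`) and by the universal machine (`RLe.allImpE`). Categorical statements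
about the effective topos are reduced to entailments in this logic. The entailments are proved by
natural deduction: in such a term `RLe.refl _` is the whole context, and a path of projections
`.left` and `.right` selects a hypothesis, the last one added by `RLe.exE` or `RLe.allImpI` being
the outermost right conjunct. Two functional relations are
equal as arrows as soon as one entails the other (`ofFunctional_eq_iff`), internally surjective
relations are epic (`epi_of_surjective`), and monomorphisms are internally injective
(`injective_of_mono`), so that each of them is isomorphic to the inclusion of a strict relational
predicate (`exists_iso_sub`). The pullback of a predicate `P` along `H` is `∃ b, H a b ∧ P b`
(`exists_isPullback_incl`, `equiv_of_isPullback_incl`).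

Finite limits are the evident products and the equalizers `∃ b, F a b ∧ G a b`. The power object of
`B` is the set of all maps `S : B → P(ℕ)`; its relation realizes that the two maps are strict,
relational, and contained in each other. A relation `Q` on `B × A` is named by
`a ↦ (b ↦ Q (b, a))` (`existsUnique_name`).

For the epsilon-calculus, the essential point is that a sentence is a single subset of `ℕ`, so that
classically it is empty or valid. If `A ⟶ 1` is epic, or if `A` is merely not initial, some
`ρ (a, a)` is inhabited. When `⋃ a, P a` is inhabited, choose `a` with `P a` inhabited, and any `a`
with `ρ (a, a)` inhabited otherwise: the global element `ε` given by `a` has the property that `P`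
pulled back along `ε`, which is the sentence `P a`, is equivalent to `⋃ a, P a`
(`exists_epsilon`).

The axiom of choice fails for the quotient of the natural numbers by the relation of being together
in the halting set or together in its complement. The quotient map is epic because a realizer of
a class is itself a member of this class, while a section would yield a code that decides the halting problem
(`not_splitEpiCategory`).
-/

namespace EffTopos

/-! ### Implication and universal quantification in the realizability order -/

section Realizability

open Nat.Partrec (Code)

/-- Introduction rule for `∀ y, φ y → ψ y`: currying of codes. The quantifier stands in front of an
implication because for an empty `Y` the premise provides no value to return. -/
theorem RLe.allImpI {X Y : Type*} {Γ : X → Set ℕ} {φ ψ : X → Y → Set ℕ}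
    (h : RLe (fun p : X × Y => conj (Γ p.1) (φ p.1 p.2)) (fun p => ψ p.1 p.2)) :
    RLe Γ (fun x => ⋂ y, imp (φ x y) (ψ x y)) := by
  obtain ⟨n, hn⟩ := h
  have hcomp : Computable fun a : ℕ => Encodable.encode ((Code.ofNatCode n).curry a) :=
    (Primrec.encode.comp
      (Code.primrec₂_curry.comp (Primrec.const _) Primrec.id)).to_comp
  obtain ⟨c, hc⟩ := Code.exists_code.1 (Partrec.nat_iff.1 hcomp.partrec)
  refine RLe.of_map c _ (fun a => congrFun hc a) fun x a ha => Set.mem_iInter.2 fun y b hb => ?_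
  have hk : Code.ofNatCode (Encodable.encode ((Code.ofNatCode n).curry a)) =
      (Code.ofNatCode n).curry a := by
    rw [← Code.ofNatCode_eq, Denumerable.ofNat_encode]
  obtain ⟨v, hv, hv'⟩ := hn (x, y) (Nat.pair a b) (by simpa [conj] using ⟨ha, hb⟩)
  exact ⟨v, by simpa [app, hk, Code.eval_curry] using hv, hv'⟩

/-- Elimination rule for `∀ y, φ y → ψ y`: evaluation by a universal machine. -/
theorem RLe.allImpE {X Y : Type*} {Γ : X → Set ℕ} {φ ψ : X → Y → Set ℕ} (y : X → Y)
    (h : RLe Γ (fun x => ⋂ y, imp (φ x y) (ψ x y))) (k : RLe Γ (fun x => φ x (y x))) :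
    RLe Γ (fun x => ψ x (y x)) := by
  refine (h.and k).trans ?_
  have huniv : Partrec fun a : ℕ => app a.unpair.1 a.unpair.2 := by
    have := Code.eval_part.comp
      ((Computable.ofNat Code).comp (Computable.fst.comp Computable.unpair))
      (Computable.snd.comp Computable.unpair)
    simpa [app, Code.ofNatCode_eq] using this
  obtain ⟨c, hc⟩ := Code.exists_code.1 (Partrec.nat_iff.1 huniv)
  refine RLe.of_code c fun x a ha => ?_
  rw [hc]
  exact Set.mem_iInter.1 ha.1 (y x) _ ha.2

/-- Over a domain with at most one point the realizability order only compares inhabitedness. -/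
theorem RLe.of_subsingleton {X : Type*} [Subsingleton X] {φ ψ : X → Set ℕ}
    (h : ∀ x, (φ x).Nonempty → (ψ x).Nonempty) : RLe φ ψ := by
  by_cases hx : ∃ x, (φ x).Nonempty
  · obtain ⟨x, hx⟩ := hx
    obtain ⟨n, hn⟩ := h x hx
    exact RLe.const n fun y => Subsingleton.elim x y ▸ hn
  · exact ⟨0, fun x a ha => (hx ⟨x, a, ha⟩).elim⟩

theorem RLe.univ {X : Type*} {Γ : X → Set ℕ} : RLe Γ (fun _ => Set.univ) :=
  RLe.const 0 fun _ => trivial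

theorem RLe.nonempty {X : Type*} {φ ψ : X → Set ℕ} (h : RLe φ ψ) {x : X} (hx : (φ x).Nonempty) :
    (ψ x).Nonempty := by
  obtain ⟨n, hn⟩ := h
  obtain ⟨a, ha⟩ := hx
  obtain ⟨b, -, hb⟩ := hn x a ha
  exact ⟨b, hb⟩

end Realizability

namespace Eff

/-! ### Calculus of functional relations -/

section Arrows

variable {A B C : Eff.{u}}

theorem exists_ofFunctional (f : A ⟶ B) : ∃ F hF, f = ofFunctional (A := A) (B := B) F hF := by
  obtain ⟨F, hF⟩ := f
  exact ⟨F, hF, rfl⟩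

theorem ofFunctional_comp {F : A.carrier → B.carrier → Set ℕ} {G : B.carrier → C.carrier → Set ℕ}
    (hF : IsFunctional A B F) (hG : IsFunctional B C G) :
    ofFunctional F hF ≫ ofFunctional G hG =
      ofFunctional (fun a c => ⋃ b, conj (F a b) (G b c)) (hF.comp hG) := rfl

/-- Comparable functional relations are equivalent, by totality of the smaller one and
single-valuedness of the larger one. -/
theorem _root_.EffTopos.IsFunctional.le_symm {F G : A.carrier → B.carrier → Set ℕ}
    (hF : IsFunctional A B F) (hG : IsFunctional A B G)
    (h : RLe (fun p : A.carrier × B.carrier => F p.1 p.2) (fun p => G p.1 p.2)) :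
    RLe (fun p : A.carrier × B.carrier => G p.1 p.2) (fun p => F p.1 p.2) :=
  (hF.exists_of (hG.dom (RLe.refl _))).exE
    (hF.subst (RLe.refl _).right (hF.dom (RLe.refl _).right)
      (hG.unique ((RLe.refl _).right.trans
        (h.comap fun p : (A.carrier × B.carrier) × B.carrier => (p.1.1, p.2))) (RLe.refl _).left))

theorem ofFunctional_eq_iff {F G : A.carrier → B.carrier → Set ℕ} {hF : IsFunctional A B F}
    {hG : IsFunctional A B G} : ofFunctional F hF = ofFunctional G hG ↔
      RLe (fun p : A.carrier × B.carrier => F p.1 p.2) (fun p => G p.1 p.2) :=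
  ⟨fun h => (Quotient.exact h).1, fun h => Quotient.sound ⟨h, hF.le_symm hG h⟩⟩

theorem isFunctional_ofMap (f : A.carrier → B.carrier)
    (hf : RLe (fun p : A.carrier × A.carrier => A.rel p.1 p.2) (fun p => B.rel (f p.1) (f p.2))) :
    IsFunctional A B (fun a b => conj (A.rel a a) (B.rel (f a) b)) where
  strict := valid₂.2 ((RLe.refl _).left.and (refl_right (RLe.refl _).right))
  relational := valid₄.2 ((refl_right (RLe.refl _).left.right).and
    (trans' (symm' ((RLe.refl _).left.right.trans
      (hf.comap fun p : A.carrier × A.carrier × B.carrier × B.carrier => (p.1, p.2.1))))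
      (trans' (RLe.refl _).left.left.right (RLe.refl _).right)))
  singleValued := valid₃.2 (trans' (symm' (RLe.refl _).left.right) (RLe.refl _).right.right)
  total := valid₁.2 (RLe.exI f ((RLe.refl _).and (hf.comap fun a => (a, a))))

/-- The arrow tracked by a map of the underlying sets that preserves the realizability relations. -/
def ofMap (f : A.carrier → B.carrier)
    (hf : RLe (fun p : A.carrier × A.carrier => A.rel p.1 p.2) (fun p => B.rel (f p.1) (f p.2))) :
    A ⟶ B := ofFunctional _ (isFunctional_ofMap f hf)

theorem ofMap_comp_eq_iff {f : A.carrier → B.carrier}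
    {hf : RLe (fun p : A.carrier × A.carrier => A.rel p.1 p.2) (fun p => B.rel (f p.1) (f p.2))}
    {G : B.carrier → C.carrier → Set ℕ} (hG : IsFunctional B C G)
    {H : A.carrier → C.carrier → Set ℕ} (hH : IsFunctional A C H) :
    ofMap f hf ≫ ofFunctional G hG = ofFunctional H hH ↔
      RLe (fun p : A.carrier × C.carrier => conj (A.rel p.1 p.1) (G (f p.1) p.2))
        (fun p => H p.1 p.2) := by
  refine ofFunctional_eq_iff.trans ⟨fun h => RLe.trans ?_ h, fun h => RLe.trans ?_ h⟩
  · exact RLe.exI (fun p => f p.1) (((RLe.refl _).left.and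
      (hG.dom (RLe.refl _).right)).and (RLe.refl _).right)
  · exact (RLe.refl _).exE ((RLe.refl _).right.left.left.and
      (hG.subst (RLe.refl _).right.right (symm' (RLe.refl _).right.left.right)
        (hG.cod (RLe.refl _).right.right)))

/-- A functional relation that is surjective in the internal sense represents an epimorphism. -/
theorem epi_of_surjective {F : A.carrier → B.carrier → Set ℕ} (hF : IsFunctional A B F)
    (h : RLe (fun b => B.rel b b) (fun b => ⋃ a, F a b)) : Epi (ofFunctional F hF) := by
  refine ⟨fun {C} g g' hg => ?_⟩
  obtain ⟨G, hG, rfl⟩ := exists_ofFunctional g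
  obtain ⟨G', hG', rfl⟩ := exists_ofFunctional g'
  rw [ofFunctional_comp, ofFunctional_comp, ofFunctional_eq_iff] at hg
  rw [ofFunctional_eq_iff]
  refine ((hG.dom (RLe.refl _)).trans (h.comap fun p : B.carrier × C.carrier => p.1)).exE ?_
  refine RLe.exE (RLe.trans (RLe.exI (fun p => p.1.1) ((RLe.refl _).right.and (RLe.refl _).left))
    (hg.comap fun p : (B.carrier × C.carrier) × A.carrier => (p.2, p.1.2))) ?_
  exact hG'.subst (RLe.refl _).right.right
    (hF.unique (RLe.refl _).right.left (RLe.refl _).left.right) (hG'.cod (RLe.refl _).right.right)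

end Arrows

/-! ### The terminal object and binary products -/

theorem eq_toOne {A : Eff.{u}} (f : A ⟶ one) : f = A.toOne := by
  obtain ⟨F, hF, rfl⟩ := exists_ofFunctional f
  exact ofFunctional_eq_iff.2 (hF.dom (RLe.refl _))

/-- `(1, ⊤)` is terminal. -/
def isTerminalOne : IsTerminal one.{u} := IsTerminal.ofUniqueHom toOne fun _ => eq_toOne

/-- The product of `(A, ρ)` and `(B, σ)`: the set `A × B` with the conjunction of `ρ` and `σ`. -/
def prodObj (A B : Eff.{u}) : Eff.{u} where
  carrier := A.carrier × B.carrier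
  rel p q := conj (A.rel p.1 q.1) (B.rel p.2 q.2)
  symm := valid₂.2 ((symm' (RLe.refl _).left).and (symm' (RLe.refl _).right))
  trans := valid₃.2 ((trans' (RLe.refl _).left.left (RLe.refl _).right.left).and
    (trans' (RLe.refl _).left.right (RLe.refl _).right.right))

section Products

variable {A B C : Eff.{u}}

/-- The first projection. -/
def fst (A B : Eff.{u}) : prodObj A B ⟶ A :=
  ofMap (A := prodObj A B) (B := A) (fun p => p.1) (RLe.refl _).left

/-- The second projection. -/
def snd (A B : Eff.{u}) : prodObj A B ⟶ B :=
  ofMap (A := prodObj A B) (B := B) (fun p => p.2) (RLe.refl _).right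

theorem isFunctional_pair {F : C.carrier → A.carrier → Set ℕ} {G : C.carrier → B.carrier → Set ℕ}
    (hF : IsFunctional C A F) (hG : IsFunctional C B G) :
    IsFunctional C (prodObj A B) (fun c p => conj (F c p.1) (G c p.2)) where
  strict := valid₂.2 ((hF.dom (RLe.refl _).left).and
    ((hF.cod (RLe.refl _).left).and (hG.cod (RLe.refl _).right)))
  relational := valid₄.2
    ((hF.subst (RLe.refl _).left.left.left (RLe.refl _).left.right (RLe.refl _).right.left).and
      (hG.subst (RLe.refl _).left.left.right (RLe.refl _).left.right (RLe.refl _).right.right))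
  singleValued := valid₃.2 ((hF.unique (RLe.refl _).left.left (RLe.refl _).right.left).and
    (hG.unique (RLe.refl _).left.right (RLe.refl _).right.right))
  total := valid₁.2 ((hF.exists_of (RLe.refl _)).exE ((hG.exists_of (RLe.refl _).left).exE
    (RLe.exI (fun p => (p.1.2, p.2)) ((RLe.refl _).left.right.and (RLe.refl _).right))))

theorem pair_fst {F : C.carrier → A.carrier → Set ℕ} {G : C.carrier → B.carrier → Set ℕ}
    (hF : IsFunctional C A F) (hG : IsFunctional C B G) :
    ofFunctional _ (isFunctional_pair hF hG) ≫ fst A B = ofFunctional F hF :=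
  ofFunctional_eq_iff.2 ((RLe.refl _).exE (hF.subst (RLe.refl _).right.left.left
    (hF.dom (RLe.refl _).right.left.left) (RLe.refl _).right.right.right))

theorem pair_snd {F : C.carrier → A.carrier → Set ℕ} {G : C.carrier → B.carrier → Set ℕ}
    (hF : IsFunctional C A F) (hG : IsFunctional C B G) :
    ofFunctional _ (isFunctional_pair hF hG) ≫ snd A B = ofFunctional G hG :=
  ofFunctional_eq_iff.2 ((RLe.refl _).exE (hG.subst (RLe.refl _).right.left.right
    (hG.dom (RLe.refl _).right.left.right) (RLe.refl _).right.right.right))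

theorem prod_hom_ext {f g : C ⟶ prodObj A B} (h₁ : f ≫ fst A B = g ≫ fst A B)
    (h₂ : f ≫ snd A B = g ≫ snd A B) : f = g := by
  obtain ⟨F, hF, rfl⟩ := exists_ofFunctional f
  obtain ⟨G, hG, rfl⟩ := exists_ofFunctional g
  have h₁ := ofFunctional_eq_iff.1 h₁
  have h₂ := ofFunctional_eq_iff.1 h₂
  refine ofFunctional_eq_iff.2 ?_
  have k₁ : RLe (fun p : C.carrier × A.carrier × B.carrier => F p.1 p.2)
      (fun p => ⋃ q : A.carrier × B.carrier, conj (G p.1 q)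
        (conj (conj (A.rel q.1 q.1) (B.rel q.2 q.2)) (A.rel q.1 p.2.1))) :=
    RLe.trans (RLe.exI (fun p => p.2) ((RLe.refl _).and ((hF.cod (RLe.refl _)).and
      (hF.cod (RLe.refl _)).left)))
      (h₁.comap fun p : C.carrier × A.carrier × B.carrier => (p.1, p.2.1))
  have k₂ : RLe (fun p : C.carrier × A.carrier × B.carrier => F p.1 p.2)
      (fun p => ⋃ q : A.carrier × B.carrier, conj (G p.1 q)
        (conj (conj (A.rel q.1 q.1) (B.rel q.2 q.2)) (B.rel q.2 p.2.2))) :=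
    RLe.trans (RLe.exI (fun p => p.2) ((RLe.refl _).and ((hF.cod (RLe.refl _)).and
      (hF.cod (RLe.refl _)).right)))
      (h₂.comap fun p : C.carrier × A.carrier × B.carrier => (p.1, p.2.2))
  refine k₁.exE (((RLe.refl _).left.trans
    (k₂.comap fun p : (C.carrier × A.carrier × B.carrier) × A.carrier × B.carrier => p.1)).exE ?_)
  exact hG.subst (RLe.refl _).right.left (hG.dom (RLe.refl _).right.left)
    ((trans' (hG.unique (RLe.refl _).right.left (RLe.refl _).left.right.left).left
      (RLe.refl _).left.right.right.right).and (RLe.refl _).right.right.right)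

/-- The binary product cone on `prodObj A B` is a limit. -/
noncomputable def isLimitProd (A B : Eff.{u}) :
    IsLimit (BinaryFan.mk (fst A B) (snd A B)) := by
  have h : ∀ {C : Eff.{u}} (f : C ⟶ A) (g : C ⟶ B), ∃ k : C ⟶ prodObj A B,
      k ≫ fst A B = f ∧ k ≫ snd A B = g := by
    intro C f g
    obtain ⟨F, hF, rfl⟩ := exists_ofFunctional f
    obtain ⟨G, hG, rfl⟩ := exists_ofFunctional g
    exact ⟨_, pair_fst hF hG, pair_snd hF hG⟩
  exact BinaryFan.isLimitMk (fun s => (h s.fst s.snd).choose)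
    (fun s => (h s.fst s.snd).choose_spec.1) (fun s => (h s.fst s.snd).choose_spec.2)
    (fun s m h₁ h₂ => prod_hom_ext (h₁.trans (h s.fst s.snd).choose_spec.1.symm)
      (h₂.trans (h s.fst s.snd).choose_spec.2.symm))

end Products

/-! ### Subobjects as strict relational predicates -/

section Subobjects

variable {A B : Eff.{u}}

theorem IsStrictRel.ext_rel {P : A.carrier → Set ℕ} (hP : A.IsStrictRel P) {X : Type*}
    {Γ : X → Set ℕ} {a : X → A.carrier} (h : RLe Γ (fun x => P (a x))) :
    RLe Γ (fun x => A.rel (a x) (a x)) :=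
  h.trans ((valid₁.1 hP.strict).comap a)

/-- A functional relation into `A` whose values satisfy `P` is also a functional relation into the
subobject `P`. -/
theorem isFunctional_lift {P : A.carrier → Set ℕ} (hP : A.IsStrictRel P)
    {F : B.carrier → A.carrier → Set ℕ} (hF : IsFunctional B A F)
    (h : RLe (fun p : B.carrier × A.carrier => F p.1 p.2) (fun p => P p.2)) :
    IsFunctional B (A.sub P hP) F where
  strict := valid₂.2 ((hF.dom (RLe.refl _)).and ((hF.cod (RLe.refl _)).and h))
  relational := valid₄.2
    (hF.subst (RLe.refl _).left.left (RLe.refl _).left.right (RLe.refl _).right.left)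
  singleValued := valid₃.2 ((hF.unique (RLe.refl _).left (RLe.refl _).right).and
    ((RLe.refl _).left.trans
      (h.comap fun p : B.carrier × A.carrier × A.carrier => (p.1, p.2.1))))
  total := hF.total

theorem lift_incl {P : A.carrier → Set ℕ} (hP : A.IsStrictRel P)
    {F : B.carrier → A.carrier → Set ℕ} (hF : IsFunctional B A F)
    (h : RLe (fun p : B.carrier × A.carrier => F p.1 p.2) (fun p => P p.2)) :
    ofFunctional (A := B) (B := A.sub P hP) F (isFunctional_lift hP hF h) ≫ A.incl P hP =
      ofFunctional F hF :=
  ofFunctional_eq_iff.2 ((RLe.refl _).exE (hF.subst (RLe.refl _).right.left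
    (hF.dom (RLe.refl _).right.left) (RLe.refl _).right.right.left))

/-- An arrow factors through the subobject `P` exactly when its values satisfy `P`. -/
theorem exists_lift_iff {P : A.carrier → Set ℕ} (hP : A.IsStrictRel P)
    {F : B.carrier → A.carrier → Set ℕ} (hF : IsFunctional B A F) :
    (∃ k, k ≫ A.incl P hP = ofFunctional F hF) ↔
      RLe (fun p : B.carrier × A.carrier => F p.1 p.2) (fun p => P p.2) := by
  refine ⟨?_, fun h => ⟨_, lift_incl hP hF h⟩⟩
  rintro ⟨k, hk⟩
  obtain ⟨K, hK, rfl⟩ := exists_ofFunctional k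
  refine (ofFunctional_eq_iff.1 hk.symm).trans ((RLe.refl _).exE ?_)
  exact hP.subst (RLe.refl _).right.right.left (RLe.refl _).right.right.right

theorem mono_of_injective {F : A.carrier → B.carrier → Set ℕ} (hF : IsFunctional A B F)
    (h : RLe (fun p : (A.carrier × A.carrier) × B.carrier => conj (F p.1.1 p.2) (F p.1.2 p.2))
      (fun p => A.rel p.1.1 p.1.2)) : Mono (ofFunctional F hF) := by
  refine ⟨fun {C} g g' hg => ?_⟩
  obtain ⟨G, hG, rfl⟩ := exists_ofFunctional g
  obtain ⟨G', hG', rfl⟩ := exists_ofFunctional g'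
  have hg := ofFunctional_eq_iff.1 hg
  refine ofFunctional_eq_iff.2 ((hF.exists_of (hG.cod (RLe.refl _))).exE ?_)
  refine RLe.exE (RLe.trans (RLe.exI (fun p => p.1.2) (RLe.refl _))
    (hg.comap fun p : (C.carrier × A.carrier) × B.carrier => (p.1.1, p.2))) ?_
  exact hG'.subst (RLe.refl _).right.left (hG'.dom (RLe.refl _).right.left)
    (((RLe.refl _).right.right.and (RLe.refl _).left.right).trans
      (h.comap fun p : ((C.carrier × A.carrier) × B.carrier) × A.carrier =>
        ((p.2, p.1.1.2), p.1.2)))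

theorem mono_incl {P : A.carrier → Set ℕ} (hP : A.IsStrictRel P) : Mono (A.incl P hP) :=
  mono_of_injective _ ((trans' (RLe.refl _).left.left (symm' (RLe.refl _).right.left)).and
    (RLe.refl _).left.right)

/-- Functional relations representing monomorphisms are injective in the internal sense: compare
the two projections of the kernel pair. -/
theorem injective_of_mono {F : A.carrier → B.carrier → Set ℕ} (hF : IsFunctional A B F)
    (hm : Mono (ofFunctional F hF)) :
    RLe (fun p : (A.carrier × A.carrier) × B.carrier => conj (F p.1.1 p.2) (F p.1.2 p.2))
      (fun p => A.rel p.1.1 p.1.2) := by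
  have hP : (prodObj A A).IsStrictRel fun q => ⋃ b, conj (F q.1 b) (F q.2 b) :=
    { strict := valid₁.2 ((RLe.refl _).exE
        ((hF.dom (RLe.refl _).right.left).and (hF.dom (RLe.refl _).right.right)))
      relational := valid₂.2 ((RLe.refl _).right.exE (RLe.exI (fun p => p.2)
        ((hF.subst (RLe.refl _).right.left (RLe.refl _).left.left.left
            (hF.cod (RLe.refl _).right.left)).and
          (hF.subst (RLe.refl _).right.right (RLe.refl _).left.left.right
            (hF.cod (RLe.refl _).right.right))))) }
  let p₁ : (prodObj A A).sub _ hP ⟶ A :=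
    ofMap (A := (prodObj A A).sub _ hP) (B := A) (fun q => q.1) (RLe.refl _).left.left
  let p₂ : (prodObj A A).sub _ hP ⟶ A :=
    ofMap (A := (prodObj A A).sub _ hP) (B := A) (fun q => q.2) (RLe.refl _).left.right
  have hp : p₁ ≫ ofFunctional F hF = p₂ ≫ ofFunctional F hF := by
    refine (ofMap_comp_eq_iff hF _).2 ?_
    refine (RLe.refl _).left.right.exE (RLe.exI (fun p => p.1.1.2) ?_)
    exact ((RLe.refl _).left.left.and (hF.dom (RLe.refl _).right.right)).and
      (hF.subst (RLe.refl _).right.right (hF.dom (RLe.refl _).right.right)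
        (hF.unique (RLe.refl _).right.left (RLe.refl _).left.right))
  have h := ofFunctional_eq_iff.1 (hm.right_cancellation _ _ hp)
  have h' := (RLe.and (RLe.and ((hF.dom (RLe.refl _).left).and (hF.dom (RLe.refl _).right))
    (RLe.exI (fun p => p.2) (RLe.refl _))) (hF.dom (RLe.refl _).left)).trans
    (h.comap fun p : (A.carrier × A.carrier) × B.carrier => (p.1, p.1.1))
  exact symm' h'.right

/-- Every monomorphism is isomorphic to the inclusion of a strict relational predicate, namely its
internal image. -/
theorem exists_iso_sub (r : B ⟶ A) (hr : Mono r) :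
    ∃ (P : A.carrier → Set ℕ) (hP : A.IsStrictRel P) (i : B ≅ A.sub P hP),
      i.hom ≫ A.incl P hP = r := by
  obtain ⟨F, hF, rfl⟩ := exists_ofFunctional r
  have hinj := injective_of_mono hF hr
  have hP : A.IsStrictRel fun a => ⋃ b, F b a :=
    { strict := valid₁.2 ((RLe.refl _).exE (hF.cod (RLe.refl _).right))
      relational := valid₂.2 ((RLe.refl _).right.exE (RLe.exI (fun p => p.2)
        (hF.subst (RLe.refl _).right (hF.dom (RLe.refl _).right) (RLe.refl _).left.left))) }
  have hle : RLe (fun p : B.carrier × A.carrier => F p.1 p.2) (fun p => ⋃ b, F b p.2) :=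
    RLe.exI (fun p => p.1) (RLe.refl _)
  have hG : IsFunctional (A.sub _ hP) B (fun a b => F b a) :=
    { strict := valid₂.2 (((hF.cod (RLe.refl _)).and
        (RLe.exI (fun p : A.carrier × B.carrier => p.2) (RLe.refl _))).and
        (hF.dom (RLe.refl _)))
      relational := valid₄.2
        (hF.subst (RLe.refl _).left.left (RLe.refl _).right (RLe.refl _).left.right.left)
      singleValued := valid₃.2 (hinj.comap
        fun p : A.carrier × B.carrier × B.carrier => ((p.2.1, p.2.2), p.1))
      total := valid₁.2 (RLe.refl _).right }
  refine ⟨_, hP, ⟨ofFunctional (A := B) (B := A.sub _ hP) F (isFunctional_lift hP hF hle),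
    ofFunctional _ hG, ?_, ?_⟩,
    lift_incl hP hF hle⟩
  · refine ofFunctional_eq_iff.2 ((RLe.refl _).exE ((RLe.refl _).right.trans ?_))
    exact hinj.comap fun p : (B.carrier × B.carrier) × A.carrier => (p.1, p.2)
  · exact ofFunctional_eq_iff.2 ((RLe.refl _).exE
      ((hF.unique (RLe.refl _).right.left (RLe.refl _).right.right).and
        (RLe.exI (fun p : (A.carrier × A.carrier) × B.carrier => p.2) (RLe.refl _).right.left)))

/-- The pullback of the subobject `P` along `H` is the subobject `∃ b, H a b ∧ P b`. -/
theorem exists_isPullback_incl {H : A.carrier → B.carrier → Set ℕ} (hH : IsFunctional A B H)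
    {P : B.carrier → Set ℕ} (hP : B.IsStrictRel P) {Q : A.carrier → Set ℕ} (hQ : A.IsStrictRel Q)
    (h₁ : RLe Q (fun a => ⋃ b, conj (H a b) (P b)))
    (h₂ : RLe (fun a => ⋃ b, conj (H a b) (P b)) Q) :
    ∃ g, IsPullback g (A.incl Q hQ) (B.incl P hP) (ofFunctional H hH) := by
  have := mono_incl hP
  have := mono_incl hQ
  obtain ⟨g, hg⟩ := (exists_lift_iff hP ((isFunctional_incl A Q hQ).comp hH)).2
    ((RLe.refl _).exE (((RLe.refl _).right.left.right.trans
      (h₁.comap fun p : (A.carrier × B.carrier) × A.carrier => p.1.1)).exE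
      (hP.subst (hH.unique (RLe.refl _).right.left
        (hH.subst (RLe.refl _).left.right.right (symm' (RLe.refl _).left.right.left.left)
          (hH.cod (RLe.refl _).left.right.right))) (RLe.refl _).right.right)))
  have hg : g ≫ B.incl P hP = A.incl Q hQ ≫ ofFunctional H hH := hg
  refine ⟨g, ⟨⟨hg⟩, ⟨PullbackCone.isLimitAux' _ fun s => ?_⟩⟩⟩
  have hs : ∃ k, k ≫ A.incl Q hQ = s.snd := by
    obtain ⟨S, hS, e⟩ := exists_ofFunctional s.snd
    have hc : ∃ k, k ≫ B.incl P hP = ofFunctional _ (hS.comp hH) :=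
      ⟨s.fst, by rw [s.condition, e, ofFunctional_comp]⟩
    rw [exists_lift_iff] at hc
    rw [e, exists_lift_iff]
    -- a value `a` of `S` satisfies `Q`, as witnessed by any value `b` of `H` at `a`
    refine RLe.trans ?_ (h₂.comap fun p : s.pt.carrier × A.carrier => p.2)
    refine (hH.exists_of (hS.cod (RLe.refl _))).exE (RLe.exI (fun p => p.2) ?_)
    exact (RLe.refl _).right.and (RLe.trans (RLe.exI (fun p => p.1.2) (RLe.refl _))
      (hc.comap fun p : (_ × A.carrier) × B.carrier => (p.1.1, p.2)))
  refine ⟨hs.choose, ?_, hs.choose_spec, fun {m} _ hm => ?_⟩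
  · refine (cancel_mono (B.incl P hP)).1 ?_
    exact (Category.assoc _ _ _).trans ((congrArg _ hg).trans ((Category.assoc _ _ _).symm.trans
      ((congrArg (· ≫ ofFunctional H hH) hs.choose_spec).trans s.condition.symm)))
  · exact (cancel_mono (A.incl Q hQ)).1 (hm.trans hs.choose_spec.symm)

/-- A subobject that is a pullback of `P` along `H` is equivalent to `∃ b, H a b ∧ P b`. -/
theorem equiv_of_isPullback_incl {H : A.carrier → B.carrier → Set ℕ} (hH : IsFunctional A B H)
    {P : B.carrier → Set ℕ} (hP : B.IsStrictRel P) {Q : A.carrier → Set ℕ} (hQ : A.IsStrictRel Q)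
    {g : A.sub Q hQ ⟶ B.sub P hP}
    (h : IsPullback g (A.incl Q hQ) (B.incl P hP) (ofFunctional H hH)) :
    RLe Q (fun a => ⋃ b, conj (H a b) (P b)) ∧ RLe (fun a => ⋃ b, conj (H a b) (P b)) Q := by
  have hR : A.IsStrictRel fun a => ⋃ b, conj (H a b) (P b) :=
    { strict := valid₁.2 ((RLe.refl _).exE (hH.dom (RLe.refl _).right.left))
      relational := valid₂.2 ((RLe.refl _).right.exE (RLe.exI (fun p => p.2)
        ((hH.subst (RLe.refl _).right.left (RLe.refl _).left.left
          (hH.cod (RLe.refl _).right.left)).and (RLe.refl _).right.right))) }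
  have key : ∀ {Q Q' : A.carrier → Set ℕ} (hQ : A.IsStrictRel Q) (hQ' : A.IsStrictRel Q'),
      (∃ k, k ≫ A.incl Q' hQ' = A.incl Q hQ) → RLe Q Q' := fun hQ hQ' hk =>
    RLe.trans ((hQ.ext_rel (RLe.refl _)).and (RLe.refl _))
      (((exists_lift_iff hQ' (isFunctional_incl A _ hQ)).1 hk).comap fun a => (a, a))
  obtain ⟨g', h'⟩ := exists_isPullback_incl hH hP hR (RLe.refl _) (RLe.refl _)
  exact ⟨key _ _ ⟨_, h'.lift_snd g _ h.w⟩, key _ _ ⟨_, h.lift_snd g' _ h'.w⟩⟩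

end Subobjects

/-! ### Finite limits -/

/-- The equalizer of `F` and `G` is the subobject `∃ b, F a b ∧ G a b`. -/
theorem hasEqualizer {A B : Eff.{u}} (f g : A ⟶ B) : HasEqualizer f g := by
  obtain ⟨F, hF, rfl⟩ := exists_ofFunctional f
  obtain ⟨G, hG, rfl⟩ := exists_ofFunctional g
  have hP : A.IsStrictRel fun a => ⋃ b, conj (F a b) (G a b) :=
    { strict := valid₁.2 ((RLe.refl _).exE (hF.dom (RLe.refl _).right.left))
      relational := valid₂.2 ((RLe.refl _).right.exE (RLe.exI (fun p => p.2)
        ((hF.subst (RLe.refl _).right.left (RLe.refl _).left.left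
          (hF.cod (RLe.refl _).right.left)).and
        (hG.subst (RLe.refl _).right.right (RLe.refl _).left.left
          (hG.cod (RLe.refl _).right.right))))) }
  have := mono_incl hP
  have w : A.incl _ hP ≫ ofFunctional F hF = A.incl _ hP ≫ ofFunctional G hG := by
    refine ofFunctional_eq_iff.2 ((RLe.refl _).exE (RLe.exI (fun p => p.2)
      ((RLe.refl _).right.left.and ((RLe.refl _).right.left.right.exE ?_))))
    exact hG.subst (RLe.refl _).right.right (RLe.refl _).left.right.left.left
      (hF.unique (hF.subst (RLe.refl _).right.left (RLe.refl _).left.right.left.left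
        (hF.cod (RLe.refl _).right.left)) (RLe.refl _).left.right.right)
  have hl : ∀ s : Fork (ofFunctional F hF) (ofFunctional G hG), ∃ k, k ≫ A.incl _ hP = s.ι := by
    intro s
    have hs := s.condition
    obtain ⟨S, hS, e⟩ := exists_ofFunctional s.ι
    rw [e] at hs ⊢
    have hs := ofFunctional_eq_iff.1 hs
    refine (exists_lift_iff hP hS).2 ((hF.exists_of (hS.cod (RLe.refl _))).exE
      (RLe.exI (fun p => p.2) ((RLe.refl _).right.and ?_)))
    refine RLe.exE (RLe.trans (RLe.exI (fun p => p.1.2) (RLe.refl _))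
      (hs.comap fun p : (s.pt.carrier × A.carrier) × B.carrier => (p.1.1, p.2))) ?_
    exact hG.subst (RLe.refl _).right.right
      (hS.unique (RLe.refl _).right.left (RLe.refl _).left.left) (hG.cod (RLe.refl _).right.right)
  exact ⟨⟨⟨Fork.ofι _ w, Fork.IsLimit.mk _ (fun s => (hl s).choose)
    (fun s => (hl s).choose_spec)
    fun s m hm => (cancel_mono (A.incl _ hP)).1 (hm.trans (hl s).choose_spec.symm)⟩⟩⟩

instance hasFiniteLimits : HasFiniteLimits Eff.{u} := by
  have : HasTerminal Eff.{u} := isTerminalOne.hasTerminal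
  have : ∀ A B : Eff.{u}, HasLimit (pair A B) := fun A B => ⟨⟨⟨_, isLimitProd A B⟩⟩⟩
  have : HasBinaryProducts Eff.{u} := hasBinaryProducts_of_hasLimit_pair _
  have : HasFiniteProducts Eff.{u} := hasFiniteProducts_of_has_binary_and_terminal
  have : HasEqualizers Eff.{u} := by
    have : ∀ {A B : Eff.{u}} {f g : A ⟶ B}, HasLimit (parallelPair f g) :=
      fun {A B f g} => hasEqualizer f g
    exact hasEqualizers_of_hasLimit_parallelPair _
  exact hasFiniteLimits_of_hasEqualizers_and_finite_products

/-! ### Power objects -/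

section Power

variable {A B : Eff.{u}} {X : Type*} {Γ : X → Set ℕ} {R S T : X → B.carrier → Set ℕ}

/-- The sentence expressing that `S` is contained in `T`. -/
def inc (S T : B.carrier → Set ℕ) : Set ℕ := ⋂ b, imp (S b) (T b)

/-- The sentence expressing that `S` is strict and relational over `B`: its elements are the
pairs of a realizer of strictness and a realizer of relationality. -/
def isPred (S : B.carrier → Set ℕ) : Set ℕ :=
  conj (⋂ b, imp (S b) (B.rel b b))
    (⋂ p : B.carrier × B.carrier, imp (conj (B.rel p.1 p.2) (S p.1)) (S p.2))

theorem inc_mp {b : X → B.carrier} (h : RLe Γ (fun x => inc (S x) (T x)))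
    (k : RLe Γ (fun x => S x (b x))) : RLe Γ (fun x => T x (b x)) := RLe.allImpE b h k

theorem inc_refl : RLe Γ (fun x => inc (S x) (S x)) := RLe.allImpI (RLe.refl _).right

theorem inc_trans (h : RLe Γ (fun x => inc (R x) (S x))) (k : RLe Γ (fun x => inc (S x) (T x))) :
    RLe Γ (fun x => inc (R x) (T x)) :=
  RLe.allImpI (inc_mp ((RLe.refl _).left.trans (k.comap fun p : X × B.carrier => p.1))
    (inc_mp ((RLe.refl _).left.trans (h.comap fun p : X × B.carrier => p.1)) (RLe.refl _).right))

theorem isPred_strict {b : X → B.carrier} (h : RLe Γ (fun x => isPred (S x)))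
    (k : RLe Γ (fun x => S x (b x))) : RLe Γ (fun x => B.rel (b x) (b x)) :=
  RLe.allImpE (ψ := fun _ b => B.rel b b) b h.left k

theorem isPred_subst {b b' : X → B.carrier} (h : RLe Γ (fun x => isPred (S x)))
    (hb : RLe Γ (fun x => B.rel (b x) (b' x))) (k : RLe Γ (fun x => S x (b x))) :
    RLe Γ (fun x => S x (b' x)) :=
  RLe.allImpE (fun x => (b x, b' x)) h.right (hb.and k)

/-- The power object of `B`: all predicates on the underlying set; two of them are identified by
the realizers of their being strict, relational and mutually contained. -/
def pow (B : Eff.{u}) : Eff.{u} where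
  carrier := B.carrier → Set ℕ
  rel S T := conj (conj (isPred S) (isPred T)) (conj (inc S T) (inc T S))
  symm := valid₂.2 (((RLe.refl _).left.right.and (RLe.refl _).left.left).and
    ((RLe.refl _).right.right.and (RLe.refl _).right.left))
  trans := valid₃.2 (((RLe.refl _).left.left.left.and (RLe.refl _).right.left.right).and
    ((inc_trans (RLe.refl _).left.right.left (RLe.refl _).right.right.left).and
      (inc_trans (RLe.refl _).right.right.right (RLe.refl _).left.right.right)))

/-- The membership relation `S b`, restricted to those `S` that are strict and relational. -/
theorem isStrictRel_mem (B : Eff.{u}) :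
    (prodObj B (pow B)).IsStrictRel (fun p => conj (isPred p.2) (p.2 p.1)) where
  strict := valid₁.2 ((isPred_strict (RLe.refl _).left (RLe.refl _).right).and
    (((RLe.refl _).left.and (RLe.refl _).left).and (inc_refl.and inc_refl)))
  relational := valid₂.2 ((RLe.refl _).left.right.left.right.and
    (inc_mp (RLe.refl _).left.right.right.left
      (isPred_subst (RLe.refl _).right.left (RLe.refl _).left.left (RLe.refl _).right.right)))

variable {Q : B.carrier × A.carrier → Set ℕ}

/-- The sections `fun b => Q (b, a)` of a relation `Q` depend on `a` extensionally, and thus define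
a map from `A` to the underlying set of `pow B` that preserves the realizability relations. -/
theorem rel_pow_section (hQ : (prodObj B A).IsStrictRel Q) :
    RLe (fun p : A.carrier × A.carrier => A.rel p.1 p.2)
      (fun p => (pow B).rel (fun b => Q (b, p.1)) (fun b => Q (b, p.2))) := by
  have hp : ∀ {X : Type u} {Γ : X → Set ℕ} {a : X → A.carrier},
      RLe Γ (fun x => A.rel (a x) (a x)) →
        RLe Γ (fun x => isPred (B := B) fun b => Q (b, a x)) := by
    intro X Γ a h
    refine (RLe.allImpI ?_).and (RLe.allImpI ?_)
    · exact (hQ.ext_rel (RLe.refl _).right).left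
    · exact hQ.subst ((RLe.refl _).right.left.and ((RLe.refl _).left.trans
        (h.comap fun p : X × B.carrier × B.carrier => p.1))) (RLe.refl _).right.right
  refine ((hp (refl_left (RLe.refl _))).and (hp (refl_right (RLe.refl _)))).and
    ((RLe.allImpI ?_).and (RLe.allImpI ?_))
  · exact hQ.subst ((hQ.ext_rel (RLe.refl _).right).left.and (RLe.refl _).left) (RLe.refl _).right
  · exact hQ.subst ((hQ.ext_rel (RLe.refl _).right).left.and (symm' (RLe.refl _).left))
      (RLe.refl _).right

/-- A functional relation `F` from `A` to `pow B` induces one from `prodObj B A` to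
`prodObj B (pow B)`; it represents `id × F`. -/
theorem isFunctional_prodMap {F : A.carrier → (pow B).carrier → Set ℕ}
    (hF : IsFunctional A (pow B) F) :
    IsFunctional (prodObj B A) (prodObj B (pow B))
      (fun p q => conj (B.rel p.1 q.1) (F p.2 q.2)) where
  strict := valid₂.2 (((refl_left (RLe.refl _).left).and (hF.dom (RLe.refl _).right)).and
    ((refl_right (RLe.refl _).left).and (hF.cod (RLe.refl _).right)))
  relational := valid₄.2
    ((trans' (symm' (RLe.refl _).left.right.left)
      (trans' (RLe.refl _).left.left.left (RLe.refl _).right.left)).and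
      (hF.subst (RLe.refl _).left.left.right (RLe.refl _).left.right.right
        (RLe.refl _).right.right))
  singleValued := valid₃.2 ((trans' (symm' (RLe.refl _).left.left) (RLe.refl _).right.left).and
    (hF.unique (RLe.refl _).left.right (RLe.refl _).right.right))
  total := valid₁.2 ((hF.exists_of (RLe.refl _).right).exE
    (RLe.exI (fun p => (p.1.1, p.2)) ((RLe.refl _).left.left.and (RLe.refl _).right)))

/-- Every relation on `prodObj B A` has a unique name `A ⟶ pow B`, which sends `a` to the section
`fun b => Q (b, a)`. -/
theorem existsUnique_name (hQ : (prodObj B A).IsStrictRel Q) :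
    ∃ (N : A.carrier → (pow B).carrier → Set ℕ) (hN : IsFunctional A (pow B) N),
      (∃ g, IsPullback g ((prodObj B A).incl Q hQ) ((prodObj B (pow B)).incl _ (isStrictRel_mem B))
        (ofFunctional _ (isFunctional_prodMap hN))) ∧
      ∀ (F : A.carrier → (pow B).carrier → Set ℕ) (hF : IsFunctional A (pow B) F) (g),
        IsPullback g ((prodObj B A).incl Q hQ) ((prodObj B (pow B)).incl _ (isStrictRel_mem B))
          (ofFunctional _ (isFunctional_prodMap hF)) → ofFunctional F hF = ofFunctional N hN := by
  have hsec := rel_pow_section hQ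
  have hsec' : RLe (fun a => A.rel a a)
      (fun a => (pow B).rel (fun b => Q (b, a)) (fun b => Q (b, a))) :=
    hsec.comap fun a => (a, a)
  refine ⟨_, isFunctional_ofMap (A := A) (B := pow B) (fun a b => Q (b, a)) hsec,
    exists_isPullback_incl _ _ _ ?_ ?_, ?_⟩
  · have hrel := hQ.ext_rel (a := fun p => p) (RLe.refl Q)
    have hs := hrel.right.trans (hsec'.comap fun p : B.carrier × A.carrier => p.2)
    exact RLe.exI (fun p => (p.1, fun b => Q (b, p.2)))
      ((hrel.left.and (hrel.right.and hs)).and (hs.left.left.and (RLe.refl _)))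
  · refine (RLe.refl _).exE (hQ.subst ?_ (inc_mp
      (S := fun x : (B.carrier × A.carrier) × B.carrier × (B.carrier → Set ℕ) => x.2.2)
      (T := fun x b => Q (b, x.1.2)) (RLe.refl _).right.left.right.right.right.right
      (RLe.refl _).right.right.right))
    exact (symm' (RLe.refl _).right.left.left).and (RLe.refl _).right.left.right.left
  · intro F hF g h
    obtain ⟨h₁, h₂⟩ := equiv_of_isPullback_incl _ _ _ h
    have hs := (hF.dom (RLe.refl fun p : A.carrier × (pow B).carrier => F p.1 p.2)).trans
      (hsec'.comap fun p : A.carrier × (pow B).carrier => p.1)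
    refine ofFunctional_eq_iff.2 ((hF.dom (RLe.refl _)).and
      ((hs.left.left.and (hF.cod (RLe.refl _)).left.left).and
        ((RLe.allImpI ?_).and (RLe.allImpI ?_))))
    · -- if `Q (b, a)` then `b'` with `b' ~ b` belongs to some value `S'` of `F` at `a`, and
      -- `F` is single-valued, so that `S'` is equal to the given value `S`
      refine ((RLe.refl _).right.trans
        (h₁.comap fun p : (A.carrier × (pow B).carrier) × B.carrier => (p.2, p.1.1))).exE ?_
      exact isPred_subst (S := fun x : ((A.carrier × (B.carrier → Set ℕ)) × _) × _ => x.1.1.2)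
        (hF.cod (RLe.refl _).left.left).left.left
        (symm' (RLe.refl _).right.left.left)
        (inc_mp (S := fun x : _ × B.carrier × (B.carrier → Set ℕ) => x.2.2)
          (T := fun x : ((_ × (B.carrier → Set ℕ)) × _) × _ => x.1.1.2)
          (hF.unique (RLe.refl _).right.left.right (RLe.refl _).left.left).right.left
          (RLe.refl _).right.right.right)
    · -- conversely, `(b, S)` itself witnesses that `(b, a)` belongs to the pulled back
      -- membership relation
      have hS : RLe (fun p : (A.carrier × (B.carrier → Set ℕ)) × B.carrier =>
          conj (F p.1.1 p.1.2) (p.1.2 p.2)) (fun p => isPred p.1.2) :=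
        (hF.cod (RLe.refl _).left).left.left
      exact RLe.trans (RLe.exI (B := B.carrier × (B.carrier → Set ℕ))
        (φ := fun (x : (A.carrier × (B.carrier → Set ℕ)) × B.carrier) q =>
          conj (conj (B.rel x.2 q.1) (F x.1.1 q.2)) (conj (isPred q.2) (q.2 q.1)))
        (fun p => (p.2, p.1.2))
        (((isPred_strict hS (RLe.refl _).right).and (RLe.refl _).left).and
          (hS.and (RLe.refl _).right)))
        (h₂.comap fun p : (A.carrier × (pow B).carrier) × B.carrier => (p.2, p.1.1))

/-- The comparison between the chosen binary product and the explicit one. -/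
noncomputable def prodIso (A B : Eff.{u}) : A ⨯ B ≅ prodObj A B :=
  (prodIsProd A B).conePointUniqueUpToIso (isLimitProd A B)

theorem prodIso_hom_fst (A B : Eff.{u}) : (prodIso A B).hom ≫ fst A B = prod.fst :=
  (prodIsProd A B).conePointUniqueUpToIso_hom_comp (isLimitProd A B) ⟨WalkingPair.left⟩

theorem prodIso_hom_snd (A B : Eff.{u}) : (prodIso A B).hom ≫ snd A B = prod.snd :=
  (prodIsProd A B).conePointUniqueUpToIso_hom_comp (isLimitProd A B) ⟨WalkingPair.right⟩

theorem prodMap_comp_prodIso {F : A.carrier → (pow B).carrier → Set ℕ}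
    (hF : IsFunctional A (pow B) F) :
    prod.map (𝟙 B) (ofFunctional F hF) ≫ (prodIso B (pow B)).hom =
      (prodIso B A).hom ≫ ofFunctional _ (isFunctional_prodMap hF) := by
  have e₁ : ofFunctional _ (isFunctional_prodMap hF) ≫ fst B (pow B) = fst B A :=
    ofFunctional_eq_iff.2 ((RLe.refl _).exE
      (((refl_left (RLe.refl _).right.left.left).and (hF.dom (RLe.refl _).right.left.right)).and
        (trans' (RLe.refl _).right.left.left (RLe.refl _).right.right.right)))
  have e₂ : ofFunctional _ (isFunctional_prodMap hF) ≫ snd B (pow B) =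
      snd B A ≫ ofFunctional F hF := by
    refine (Eq.symm ((ofMap_comp_eq_iff hF _).2 ?_))
    refine RLe.exI (fun p => (p.1.1, p.2)) ?_
    exact ((RLe.refl _).left.left.and (RLe.refl _).right).and
      (((RLe.refl _).left.left.and (hF.cod (RLe.refl _).right)).and (hF.cod (RLe.refl _).right))
  refine prod_hom_ext ?_ ?_
  · rw [Category.assoc, Category.assoc, e₁, prodIso_hom_fst, prodIso_hom_fst, prod.map_fst,
      Category.comp_id]
  · rw [Category.assoc, Category.assoc, e₂, prodIso_hom_snd, prod.map_snd, ← Category.assoc,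
      prodIso_hom_snd]

theorem isPowerObject_pow (B : Eff.{u}) :
    IsPowerObject B (pow B)
      ((prodObj B (pow B)).incl _ (isStrictRel_mem B) ≫ (prodIso B (pow B)).inv) := by
  have := mono_incl (isStrictRel_mem B)
  refine ⟨inferInstance, fun A R r hr => ?_⟩
  obtain ⟨Q, hQ, i, hi⟩ := exists_iso_sub (r ≫ (prodIso B A).hom) inferInstance
  obtain ⟨N, hN, ⟨g, hg⟩, huniq⟩ := existsUnique_name hQ
  refine ⟨ofFunctional N hN, ⟨i.hom ≫ g, ?_⟩, ?_⟩
  · refine hg.of_iso i.symm (Iso.refl _) (prodIso B A).symm (prodIso B (pow B)).symm ?_ ?_ ?_ ?_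
    · simp
    · rw [Iso.symm_hom, Iso.symm_hom, Iso.comp_inv_eq, Category.assoc, ← hi, Iso.inv_hom_id_assoc]
    · simp
    · rw [Iso.symm_hom, Iso.symm_hom, Iso.eq_inv_comp, ← Category.assoc, ← prodMap_comp_prodIso,
        Category.assoc, Iso.hom_inv_id, Category.comp_id]
  · rintro f ⟨g', hg'⟩
    obtain ⟨F, hF, rfl⟩ := exists_ofFunctional f
    refine huniq F hF (i.inv ≫ g') (hg'.of_iso i (Iso.refl _) (prodIso B A) (prodIso B (pow B))
      ?_ ?_ ?_ (prodMap_comp_prodIso hF))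
    · simp
    · exact hi.symm
    · simp

instance elementaryTopos : ElementaryTopos Eff.{u} where
  hasFiniteLimits := hasFiniteLimits
  exists_powerObject B := ⟨_, _, _, isPowerObject_pow B⟩

end Power

/-! ### Global elements and the partial epsilon-calculus -/

section Epsilon

variable {A : Eff.{u}}

/-- An explicit form of the epsilon-calculus: if the sentence `⋃ a, P a` is inhabited, a point at
which `P` is inhabited serves as `ε`, and any existing point otherwise. -/
theorem exists_epsilon {a₀ : A.carrier} (ha₀ : (A.rel a₀ a₀).Nonempty) {P : A.carrier → Set ℕ}
    (hP : A.IsStrictRel P) :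
    Mono (inclOne.{u} (⋃ a, P a)) ∧
    (∃ e : A.sub P hP ⟶ subOne (⋃ a, P a), Epi e ∧
      e ≫ inclOne (⋃ a, P a) = A.incl P hP ≫ A.toOne) ∧
    ∃ (ε : one ⟶ A) (w : subOne (⋃ a, P a) ⟶ A.sub P hP),
      IsPullback w (inclOne (⋃ a, P a)) (A.incl P hP) ε := by
  refine ⟨mono_incl _, ⟨ofMap (A := A.sub P hP) (B := subOne (⋃ a, P a)) (fun _ => PUnit.unit)
    (RLe.univ.and (RLe.exI (fun p => p.1) (RLe.refl _).right)),
    epi_of_surjective _ ?_, (eq_toOne _).trans (eq_toOne _).symm⟩, ?_⟩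
  · refine (RLe.refl _).right.exE (RLe.exI (fun p => p.2) ?_)
    exact ((hP.ext_rel (RLe.refl _).right).and (RLe.refl _).right).and (RLe.refl _).left
  · obtain ⟨a, ha, haP⟩ : ∃ a, (A.rel a a).Nonempty ∧ ((⋃ a, P a).Nonempty → (P a).Nonempty) := by
      by_cases h : (⋃ a, P a).Nonempty
      · obtain ⟨n, hn⟩ := h
        obtain ⟨a, ha⟩ := Set.mem_iUnion.1 hn
        exact ⟨a, (hP.ext_rel (a := fun x => x) (RLe.refl P)).nonempty ⟨n, ha⟩, fun _ => ⟨n, ha⟩⟩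
      · exact ⟨a₀, ha₀, fun h' => (h h').elim⟩
    obtain ⟨n, hn⟩ := ha
    refine ⟨ofMap (A := one) (B := A) (fun _ => a) (RLe.const n fun _ => hn),
      exists_isPullback_incl (A := one) _ hP (isStrictRel_one _) ?_ ?_⟩
    · have : Subsingleton one.{u}.carrier := inferInstanceAs (Subsingleton PUnit)
      refine RLe.trans (RLe.of_subsingleton (ψ := fun _ => P a) fun _ => haP)
        (RLe.exI (fun _ => a) ((RLe.univ.and
          (RLe.const n fun _ => hn)).and (RLe.refl _)))
    · exact (RLe.refl _).exE (RLe.exI (fun p => p.2) (RLe.refl _).right.right)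

/-- The epsilon term for an arbitrary terminal object and an arbitrary monomorphism `p`, with the
image `U` of `X` in `T` being the pullback of `p` along `ε`. -/
theorem exists_epsilon_of_mono {T : Eff.{u}} (hT : IsTerminal T) {X A : Eff.{u}} (p : X ⟶ A)
    (hp : Mono p) (hA : ∃ a, (A.rel a a).Nonempty) :
    ∃ (U : Eff.{u}) (e : X ⟶ U) (m : U ⟶ T) (ε : T ⟶ A) (w : U ⟶ X),
      Epi e ∧ Mono m ∧ e ≫ m = p ≫ hT.from A ∧ IsPullback w m p ε := by
  obtain ⟨P, hP, i, rfl⟩ := exists_iso_sub p hp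
  obtain ⟨a₀, ha₀⟩ := hA
  obtain ⟨hm, ⟨e, he, -⟩, ε, w, hw⟩ := exists_epsilon ha₀ hP
  let t : one ≅ T := isTerminalOne.uniqueUpToIso hT
  refine ⟨_, i.hom ≫ e, inclOne _ ≫ t.hom, t.inv ≫ ε, w ≫ i.inv, inferInstance, inferInstance,
    hT.hom_ext _ _, ?_⟩
  exact hw.of_iso (Iso.refl _) i.symm t (Iso.refl _) (by simp) (by simp) (by simp) (by simp)

theorem hom_eq_of_rel_empty {B : Eff.{u}} (h : ¬ ∃ a, (A.rel a a).Nonempty) (f g : A ⟶ B) :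
    f = g := by
  obtain ⟨F, hF, rfl⟩ := exists_ofFunctional f
  obtain ⟨G, hG, rfl⟩ := exists_ofFunctional g
  exact ofFunctional_eq_iff.2 ⟨0, fun p a ha =>
    (h ⟨p.1, (hF.dom (RLe.refl _)).nonempty (x := p) ⟨a, ha⟩⟩).elim⟩

/-- An object all of whose realizability relations are empty is initial, since the empty relation is
its only functional relation to any object. -/
theorem exists_rel_of_not_initial (h : IsEmpty (IsInitial A)) : ∃ a, (A.rel a a).Nonempty := by
  by_contra hA
  have hR : ∀ {X : Type u} {Γ ψ : X → Set ℕ} {a a' : X → A.carrier},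
      RLe Γ (fun x => A.rel (a x) (a' x)) → RLe Γ ψ := fun {X Γ ψ a a'} k =>
    ⟨0, fun x n hn => (hA ⟨a x, (refl_left k).nonempty (x := x) ⟨n, hn⟩⟩).elim⟩
  have hF : ∀ B : Eff.{u}, IsFunctional A B (fun _ _ => ∅) := fun B =>
    { strict := valid₂.2 (RLe.of_subset fun _ => Set.empty_subset _)
      relational := valid₄.2 (hR (RLe.refl _).left.right)
      singleValued := valid₃.2 ((RLe.refl _).left.trans
        (RLe.of_subset fun _ => Set.empty_subset _))
      total := valid₁.2 (hR (RLe.refl _)) }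
  exact h.false (IsInitial.ofUniqueHom (fun B => ofFunctional _ (hF B))
    fun B f => hom_eq_of_rel_empty hA _ _)

/-- The assembly on `X` in which `x` is realized by the elements of `E x`: an object whose
realizability relation is only inhabited on the diagonal. -/
def assembly (X : Type u) (E : X → Set ℕ) : Eff.{u} where
  carrier := X
  rel x y := {n | x = y ∧ n ∈ E x}
  symm := valid₂.2 (RLe.of_subset fun _ _ h => ⟨h.1.symm, h.1 ▸ h.2⟩)
  trans := valid₃.2 (RLe.of_map Nat.Partrec.Code.left (fun n => n.unpair.1)
    (by simp [Nat.Partrec.Code.eval]) fun _ _ h => ⟨h.1.1.trans h.2.1, h.1.2⟩)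

/-- If `(A, ρ) ⟶ 1` is epic then `ρ (a, a)` is inhabited for some `a`: otherwise this arrow would
equalize the two elements of `1 + 1`. -/
theorem exists_rel_of_epi (h : Epi A.toOne) : ∃ a, (A.rel a a).Nonempty := by
  by_contra hA
  let c : Bool → (one.{u} ⟶ assembly (ULift.{u} Bool) fun _ => Set.univ) := fun b =>
    ofMap (A := one) (B := assembly _ _) (fun _ => ULift.up b) (RLe.const 0 fun _ => ⟨rfl, trivial⟩)
  have hc : c true = c false := h.left_cancellation _ _ (hom_eq_of_rel_empty hA _ _)
  obtain ⟨-, -, h', -⟩ := (ofFunctional_eq_iff.1 hc).nonempty (x := (PUnit.unit, ULift.up true))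
    ⟨Nat.pair 0 0, by simp [conj, one, assembly]⟩
  exact Bool.noConfusion (congrArg ULift.down h')

end Epsilon

/-! ### Failure of the axiom of choice -/

section Choice

open Nat.Partrec (Code)

/-- If `f` is the characteristic function of the halting set, no code sends the numbers in the
halting set to one value and all others to a different one. -/
theorem not_computable_choice (g : Bool → ℕ) (f : ℕ → Bool)
    (hf : ∀ n, f n = true ↔ ((Denumerable.ofNat Code n).eval 0).Dom) (hg : g true ≠ g false)
    (n : ℕ) (hn : ∀ m, g (f m) ∈ app n m) : False := by
  refine ComputablePred.halting_problem 0 ?_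
  have hcomp : Computable fun m => g (f m) := by
    have h : Partrec (app n) := Partrec.nat_iff.2 (Code.exists_code.2 ⟨_, rfl⟩)
    exact h.of_eq fun m => Part.eq_some_iff.2 (hn m)
  classical
  refine ⟨inferInstance, ?_⟩
  have hd : Computable fun c : Code => decide (g (f (Encodable.encode c)) = g true) :=
    (Primrec.eq (α := ℕ)).decide.to_comp.comp (hcomp.comp Computable.encode) (Computable.const _)
  refine hd.of_eq fun c => decide_eq_decide.2 ?_
  have hc := hf (Encodable.encode c)
  rw [Denumerable.ofNat_encode] at hc
  refine Iff.trans ?_ hc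
  cases f (Encodable.encode c) <;> simp [hg.symm]

/-- The quotient of the natural numbers that identifies two codes when both or neither of them
halt does not split: a section would choose one code in each class computably. -/
theorem not_splitEpiCategory : ¬ SplitEpiCategory Eff.{u} := by
  intro hsplit
  classical
  let f : ℕ → Bool := fun n => decide ((Denumerable.ofNat Code n).eval 0).Dom
  -- the natural numbers, and the set of booleans where the halting set realizes `true` and its
  -- complement realizes `false`
  let N : Eff.{u} := assembly (ULift.{u} ℕ) fun n => {n.down}
  let K : Eff.{u} := assembly (ULift.{u} Bool) fun b => {n | f n = b.down}
  have hmap : RLe (fun p : N.carrier × N.carrier => N.rel p.1 p.2)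
      (fun p => K.rel (ULift.up (f p.1.down)) (ULift.up (f p.2.down))) :=
    RLe.of_subset fun p m h => ⟨by rw [h.1], congrArg f h.2⟩
  let e : N ⟶ K := ofMap (A := N) (B := K) (fun n => ULift.up (f n.down)) hmap
  have he : Epi e := by
    refine epi_of_surjective _ (RLe.of_map (Code.id.pair Code.id) (fun n => Nat.pair n n)
      (by simp [Code.eval, Seq.seq]) fun b m h => ?_)
    have h2 : f m = b.down := h.2
    refine Set.mem_iUnion.2 ⟨ULift.up m, ?_⟩
    simp only [conj, Set.mem_ofPred_eq, Nat.unpair_pair]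
    exact ⟨⟨rfl, rfl⟩, ⟨congrArg ULift.up h2, rfl⟩⟩
  obtain ⟨⟨s, hs⟩⟩ := hsplit.isSplitEpi_of_epi e
  obtain ⟨G, hG, rfl⟩ := exists_ofFunctional s
  have hs := ofFunctional_eq_iff.1 hs
  have hex : ∀ b : Bool, ∃ n : ℕ, (G (ULift.up b) (ULift.up n)).Nonempty := by
    intro b
    obtain ⟨m, hm⟩ : ∃ m, f m = b := by
      cases b with
      | true => exact ⟨Encodable.encode Code.zero, by simp [f, Code.eval, pure, PFun.pure]⟩
      | false =>
        obtain ⟨c, hc⟩ := Code.exists_code.1 Nat.Partrec.none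
        exact ⟨Encodable.encode c, by simp [f, hc]⟩
    obtain ⟨v, hv⟩ := (hG.exists_of (a := fun b => b) (RLe.refl fun b => K.rel b b)).nonempty
      (x := ULift.up b) ⟨m, rfl, hm⟩
    obtain ⟨n, hn⟩ := Set.mem_iUnion.1 hv
    exact ⟨n.down, v, hn⟩
  choose g hg using hex
  -- the section picks out a single number for each boolean, and realizes it
  have huniq : ∀ (b : ULift.{u} Bool) (n : ULift.{u} ℕ), (G b n).Nonempty → n.down = g b.down := by
    rintro b n ⟨v, hv⟩
    obtain ⟨w, hw⟩ := hg b.down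
    obtain ⟨-, h, -⟩ := (valid₃.1 hG.singleValued).nonempty
      (x := (b, n, ULift.up (g b.down))) ⟨Nat.pair v w, by simpa [conj] using ⟨hv, hw⟩⟩
    exact congrArg ULift.down h
  have hfg : ∀ b, f (g b) = b := by
    intro b
    obtain ⟨w, hw⟩ := hg b
    have hK : K.rel (ULift.up (f (g b))) (ULift.up (f (g b))) (g b) := ⟨rfl, rfl⟩
    have hN : N.rel (ULift.up (g b)) (ULift.up (g b)) (g b) := ⟨rfl, rfl⟩
    obtain ⟨-, h, -⟩ := hs.nonempty (x := (ULift.up b, ULift.up (f (g b))))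
      ⟨Nat.pair w (Nat.pair (g b) (g b)), Set.mem_iUnion.2 ⟨ULift.up (g b), by
        simpa [conj] using ⟨hw, hN, hK⟩⟩⟩
    exact (congrArg ULift.down h).symm
  have hG' : RLe (fun b => K.rel b b) (fun b => ⋃ n, conj (N.rel n n) (G b n)) :=
    (hG.exists_of (RLe.refl _)).exE (RLe.exI (fun p => p.2)
      ((hG.cod (RLe.refl _).right).and (RLe.refl _).right))
  have hK : RLe (fun b => K.rel b b) (fun b => {g b.down}) := by
    refine hG'.trans (RLe.of_map Code.left (fun n => n.unpair.1) (by simp [Code.eval]) ?_)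
    intro b v hv
    obtain ⟨n, hn, hn'⟩ := Set.mem_iUnion.1 hv
    exact hn.2.trans (huniq b n ⟨_, hn'⟩)
  obtain ⟨n, hn⟩ := hK
  refine not_computable_choice g f (fun n => by simp [f]) (fun h => ?_) n fun m => ?_
  · have := congrArg f h
    rw [hfg, hfg] at this
    exact Bool.noConfusion this
  · obtain ⟨v, hv, rfl⟩ := hn (ULift.up (f m)) m ⟨rfl, rfl⟩
    exact hv

end Choice

end Eff

end EffTopos

theorem mainTheorem1 :
    -- the effective topos is an elementary topos, it is Hilbertian, and its internal language
    -- validates the partial epsilon-calculus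
    (∃ _ : EffTopos.ElementaryTopos EffTopos.Eff.{u},
      EffTopos.IsHilbertian EffTopos.Eff.{u} ∧
      EffTopos.ValidatesPartialEpsilon EffTopos.Eff.{u}) ∧
    -- it does not validate the axiom of choice
    ¬ SplitEpiCategory EffTopos.Eff.{u} ∧
    -- explicitly: `(1, ⊤)` is terminal, and for a strict relational `P` the sentence `⋃ a, P a`
    -- represents both the image in `1` of the subobject `P` and its pullback along some
    -- global element `ε`
    Nonempty (IsTerminal EffTopos.Eff.one.{u}) ∧
    ∀ (A : EffTopos.Eff.{u}) (P : A.carrier → Set ℕ) (hP : A.IsStrictRel P),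
      Epi A.toOne →
      Mono (A.incl P hP) ∧
      Mono (EffTopos.Eff.inclOne.{u} (⋃ a, P a)) ∧
      (∃ e : A.sub P hP ⟶ EffTopos.Eff.subOne (⋃ a, P a),
        Epi e ∧ e ≫ EffTopos.Eff.inclOne (⋃ a, P a) = A.incl P hP ≫ A.toOne) ∧
      ∃ (ε : EffTopos.Eff.one ⟶ A) (w : EffTopos.Eff.subOne (⋃ a, P a) ⟶ A.sub P hP),
        IsPullback w (EffTopos.Eff.inclOne (⋃ a, P a)) (A.incl P hP) ε := by
  refine ⟨⟨EffTopos.Eff.elementaryTopos, ?_, ?_⟩, EffTopos.Eff.not_splitEpiCategory,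
    ⟨EffTopos.Eff.isTerminalOne⟩, fun A P hP hA => ?_⟩
  · intro T hT X A p hp hA
    have hA' : Epi A.toOne := by
      rw [← EffTopos.Eff.eq_toOne (hT.from A ≫ (hT.uniqueUpToIso EffTopos.Eff.isTerminalOne).hom)]
      infer_instance
    obtain ⟨U, e, m, ε, w, he, hm, h, hw⟩ := EffTopos.Eff.exists_epsilon_of_mono hT p hp
      (EffTopos.Eff.exists_rel_of_epi hA')
    exact ⟨U, e, m, ε, w, he, hm, h, hw.w⟩
  · intro T hT X A p hp hA
    obtain ⟨U, e, m, ε, w, he, hm, h, hw⟩ := EffTopos.Eff.exists_epsilon_of_mono hT p hp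
      (EffTopos.Eff.exists_rel_of_not_initial hA)
    exact ⟨ε, U, e, m, U, w, m, he, hm, h, hw, 𝟙 U, Category.id_comp m⟩
  · obtain ⟨a, ha⟩ := EffTopos.Eff.exists_rel_of_epi hA
    exact ⟨EffTopos.Eff.mono_incl hP, EffTopos.Eff.exists_epsilon ha hP⟩
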